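/- Let $n\ge 2$ and let $f(x,y)=f_0x^n+f_1x^{n-1}y+\cdots+f_ny^n$ be a binary form with integer coefficients, with $f_0\neq 0$ and discriminant $\Delta(f)\ne 0$. Write $f(x,1)=f_0g(x)$, let $L=\mathbb{Q}[x]/(g(x))$, let $\theta$ be the image of $x$ in $L$, and let $N:L\to\mathbb{Q}$ be the norm. Put $\zeta_k=f_0\theta^k+f_1\theta^{k-1}+\cdots+f_{k-1}\theta$, and let $R_f=\mathrm{Span}_{\mathbb Z}\{1,\zeta_1,\dots,\zeta_{n-1}\}$, which is an order in $L$. Let $I_f$ be the $R_f$-submodule of $L$ generated by $1$ and $\theta$, with powers $I_f^k$ ($k\ge 0$, $I_f^0=R_f$) and $I_f^{-1}=\{z\in L: zI_f\subseteq R_f\}$. The natural $\mathbb{Z}$-basis of $I_f^{n-3}$ is $1,\theta,\dots,\theta^{n-3},\zeta_{n-2},\zeta_{n-1}$ if $n\ge3$, and $f_0,\ \zeta_1+f_1$ (playing the roles of $\zeta_{n-2},\zeta_{n-1}$) if $n=2$. A fractional ideal of $R_f$ is a free abelian subgroup $I\subset L$ of rank $n$ stable under $R_f$; an oriented fractional ideal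 is a fractional ideal $I$ together with a sign $\varepsilon=\pm1$. Its norm is $N(I)=\varepsilon\,[M:I]/[M:R_f]\in\mathbb{Q}^\times$, for any lattice $M\subset L$ containing $I$ and $R_f$; and $\kappa(I,\varepsilon)=(\kappa I,\mathrm{sgn}(N(\kappa))\varepsilon)$ for $\kappa\in L^\times$. The orientation given by an ordered $\mathbb{Z}$-basis of $I$ is the sign of the determinant of the matrix expressing it in the basis $1,\zeta_1,\dots,\zeta_{n-1}$ of $R_f$. Let $\mathrm{SL}_n(\mathbb{Z})$ act on pairs $(A,B)$ of integral symmetric $n\times n$ matrices by $g(A,B)=(gAg^t,gBg^t)$; the invariant form of $(A,B)$ is $(-1)^{n(n-1)/2}\det(xA-yB)$. Then: 1. The natural basis above is indeed a $\mathbb{Z}$-basis of $I_f^{n-3}$, and $N(I_f^{n-3})=1/f_0^{n-3}$ for the orientation it defines. 2. The $\mathrm{SL}_n(\mathbb{Z})$-orbits of pairs $(A,B)$ of integral symmetric $n\times n$ matrices with invariant form $f$ are in bijection with the equivalence classes of pairs $(I,\alpha)$, where $I$ is an oriented fractional ideal of $R_f$, $\alpha\in L^\times$, $I^2\subseteq\alpha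 I_f^{n-3}$ and $N(I)^2=N(\alpha)/f_0^{n-3}$ $(=N(\alpha)N(I_f^{n-3}))$. Here $(I,\alpha)$ and $(I^*,\alpha^*)$ are equivalent if there is $\kappa\in L^\times$ with $I^*=\kappa I$ (as oriented ideals) and $\alpha^*=\kappa^2\alpha$. Under this bijection the orbit of $(A,B)$ corresponds to the class of $(I,\alpha)$ if and only if there is a $\mathbb{Z}$-basis $b_1,\dots,b_n$ of $I$, of the given orientation, such that $A_{ij}$ and $B_{ij}$ are the coefficients of $\zeta_{n-1}$ and $\zeta_{n-2}$ in the expansion of $b_ib_j/\alpha$ in the natural basis of $I_f^{n-3}$. 3. Let $(A,B)$ have invariant form $f$. Its stabilizer in $\mathrm{SL}_n(\mathbb{Z})$ is a finite elementary abelian $2$-group. If $(A,B)$ arises as in 2 from $(I,\alpha)$ and a $\mathbb{Z}$-basis $b_1,\dots,b_n$ of $I$ (of either orientation), and $S=\{s\in L: sI\subseteq I\}$ is the endomorphism ring of $I$ in $L$, then this stabilizer is isomorphic to $S^\times[2]_{N=1}=\{u\in S^\times: u^2=1,\ N(u)=1\}$, by an isomorphism matching $g=(g_{ij})$ with the $u$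 such that $ub_i=\sum_j g_{ij}b_j$ for all $i$. -/

import Mathlib

open scoped Pointwise

namespace BinForm

noncomputable section

/-! ### Binary forms, the algebra `L`, the order `R_f` -/

/-- An integral binary `n`-ic form `f₀ xⁿ + f₁ xⁿ⁻¹ y + ⋯ + fₙ yⁿ`, given by its coefficients. -/
abbrev Form (n : ℕ) : Type := Fin (n + 1) → ℤ

variable {n : ℕ}

/-- The coefficient `f_i` (zero for `i > n`). -/
def cf (f : Form n) (i : ℕ) : ℤ := if h : i < n + 1 then f ⟨i, h⟩ else 0

/-- The form `f(x,y)` as a polynomial in `x = X 0` and `y = X 1`. -/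
def toPoly (f : Form n) : MvPolynomial (Fin 2) ℤ :=
  ∑ i ∈ Finset.range (n + 1),
    MvPolynomial.C (cf f i) * MvPolynomial.X 0 ^ (n - i) * MvPolynomial.X 1 ^ i

/-- The polynomial `f(x,1)`. -/
def dehom (f : Form n) : Polynomial ℤ :=
  ∑ i ∈ Finset.range (n + 1), Polynomial.C (cf f i) * Polynomial.X ^ (n - i)

/-- The discriminant `Δ(f)` of a form with `f₀ ≠ 0`: the discriminant of the degree `n`
polynomial `f(x,1)`. -/
def disc (f : Form n) : ℤ := (dehom f).discr

/-- The algebra `L = ℚ[x]/(g(x))`, where `f(x,1) = f₀ g(x)`. For `f₀ ≠ 0` the polynomials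
`f(x,1)` and `g(x)` generate the same ideal of `ℚ[x]`. -/
abbrev L (f : Form n) : Type := AdjoinRoot ((dehom f).map (Int.castRingHom ℚ))

/-- The image `θ` of `x` in `L`. -/
def theta (f : Form n) : L f := AdjoinRoot.root ((dehom f).map (Int.castRingHom ℚ))

/-- `ζ_k = f₀ θᵏ + f₁ θᵏ⁻¹ + ⋯ + f_{k-1} θ`. -/
def zeta (f : Form n) (k : ℕ) : L f :=
  ∑ i ∈ Finset.range k, (cf f i : L f) * theta f ^ (k - i)

theorem zeta_succ (f : Form n) (k : ℕ) :
    zeta f (k + 1) = theta f * (zeta f k + (cf f k : L f)) := by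
  unfold zeta
  rw [Finset.sum_range_succ, mul_add, Finset.mul_sum]
  congr 1
  · refine Finset.sum_congr rfl fun i hi => ?_
    have h : k + 1 - i = (k - i) + 1 := by
      have := Finset.mem_range.1 hi
      omega
    rw [h, pow_succ]
    ring
  · simp [mul_comm]

theorem zeta_last (f : Form n) : zeta f n = -(cf f n : L f) := by
  have h : zeta f n + (cf f n : L f) = 0 := by
    have h0 : AdjoinRoot.mk ((dehom f).map (Int.castRingHom ℚ))
        ((dehom f).map (Int.castRingHom ℚ)) = 0 := AdjoinRoot.mk_self
    rw [← h0]
    conv_rhs => arg 2; unfold dehom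
    rw [Polynomial.map_sum, map_sum, Finset.sum_range_succ]
    unfold zeta theta
    simp [AdjoinRoot.mk_X]
  exact eq_neg_of_add_eq_zero_left h

/-- `Span_ℤ {1, ζ_1, …, ζ_{n-1}}`. -/
def ringSpan (f : Form n) : Submodule ℤ (L f) :=
  Submodule.span ℤ (insert 1 (zeta f '' Set.Ico 1 n))

theorem one_mem_ringSpan (f : Form n) : (1 : L f) ∈ ringSpan f :=
  Submodule.subset_span (Set.mem_insert _ _)

theorem intCast_mem_ringSpan (f : Form n) (m : ℤ) : (m : L f) ∈ ringSpan f := by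
  have h := (ringSpan f).smul_mem m (one_mem_ringSpan f)
  rwa [zsmul_one] at h

theorem zeta_mem_ringSpan (f : Form n) {k : ℕ} (hk : k ≤ n) : zeta f k ∈ ringSpan f := by
  rcases Nat.eq_zero_or_pos k with rfl | h0
  · have : zeta f 0 = 0 := by simp [zeta]
    rw [this]
    exact zero_mem _
  · rcases hk.eq_or_lt with rfl | h1
    · rw [zeta_last]
      exact neg_mem (intCast_mem_ringSpan f _)
    · exact Submodule.subset_span (Set.mem_insert_of_mem _ ⟨k, ⟨h0, h1⟩, rfl⟩)

theorem intCast_mul_mem_ringSpan (f : Form n) (m : ℤ) {x : L f} (hx : x ∈ ringSpan f) :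
    (m : L f) * x ∈ ringSpan f := by
  rw [← zsmul_eq_mul]
  exact (ringSpan f).smul_mem m hx

theorem zeta_mul_zeta_mem (f : Form n) (i : ℕ) :
    i ≤ n → ∀ j ≤ n, zeta f i * zeta f j ∈ ringSpan f := by
  induction i with
  | zero =>
    intro _ j _
    have : zeta f 0 = 0 := by simp [zeta]
    rw [this, zero_mul]
    exact zero_mem _
  | succ i ih =>
    intro hi j hj
    rcases hj.eq_or_lt with rfl | hj'
    · rw [zeta_last, mul_comm, ← Int.cast_neg]
      exact intCast_mul_mem_ringSpan f _ (zeta_mem_ringSpan f hi)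
    · have key : zeta f (i + 1) * zeta f j = zeta f i * zeta f (j + 1)
          + (cf f i : L f) * zeta f (j + 1) - (cf f j : L f) * zeta f (i + 1) := by
        rw [zeta_succ f i, zeta_succ f j]
        ring
      rw [key]
      exact sub_mem (add_mem (ih (by omega) (j + 1) hj')
        (intCast_mul_mem_ringSpan f _ (zeta_mem_ringSpan f hj')))
        (intCast_mul_mem_ringSpan f _ (zeta_mem_ringSpan f hi))

theorem ringSpan_mul_mem (f : Form n) (x y : L f) (hx : x ∈ ringSpan f) (hy : y ∈ ringSpan f) :
    x * y ∈ ringSpan f := by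
  have h : ringSpan f * ringSpan f ≤ ringSpan f := by
    unfold ringSpan
    rw [Submodule.span_mul_span, Submodule.span_le]
    rintro _ ⟨a, ha, b, hb, rfl⟩
    change a * b ∈ ringSpan f
    rcases ha with rfl | ⟨i, hi, rfl⟩
    · rw [one_mul]
      exact Submodule.subset_span hb
    · rcases hb with rfl | ⟨j, hj, rfl⟩
      · rw [mul_one]
        exact zeta_mem_ringSpan f hi.2.le
      · exact zeta_mul_zeta_mem f i hi.2.le j hj.2.le
  exact h (Submodule.mul_mem_mul hx hy)

/-- The order `R_f = Span_ℤ {1, ζ_1, …, ζ_{n-1}}` in `L`. -/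
def order (f : Form n) : Subalgebra ℤ (L f) :=
  (ringSpan f).toSubalgebra (one_mem_ringSpan f) (ringSpan_mul_mem f)

/-! ### The ideals `I_f(k)` and `I_f^k` -/

/-- The natural `ℤ`-basis (entries `0, …, n-1`) of `I_f(k)`. For `0 ≤ k ≤ n-1` it is
`1, θ, …, θᵏ, ζ_{k+1}, …, ζ_{n-1}`; for `k = -1` it is
`f₀, ζ_1 + f_1, …, ζ_{n-1} + f_{n-1}`. For `k = 0` it is the natural basis of `R_f`. -/
def natBasis (f : Form n) (k : ℤ) (i : ℕ) : L f :=
  if k < 0 then zeta f i + (cf f i : L f)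
  else if (i : ℤ) ≤ k then theta f ^ i else zeta f i

/-- `I_f`, the `R_f`-submodule of `L` with `ℤ`-basis `1, θ, ζ_2, …, ζ_{n-1}`; as an `R_f`-module
it is generated by `1` and `θ`. -/
def idealOne (f : Form n) : Submodule (order f) (L f) := Submodule.span (order f) {1, theta f}

/-- The powers `I_f^k`, where `I_f⁻ᵐ` is `(R_f : I_f^m) = {z ∈ L | z I_f^m ⊆ R_f}`
(the zeroth power is `R_f`, the unit of the semiring of `R_f`-submodules of `L`). -/
def idealPow (f : Form n) (k : ℤ) : Submodule (order f) (L f) :=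
  if 0 ≤ k then idealOne f ^ k.toNat else 1 / idealOne f ^ (-k).toNat

/-! ### Norms and orientations -/

/-- The (unsigned) norm `N(I) = [M : I] / [M : R_f]`, computed with `M = I + R_f`. -/
def idealNorm (f : Form n) (I : Submodule (order f) (L f)) : ℚ :=
  (I.toAddSubgroup.relIndex (I ⊔ 1).toAddSubgroup : ℚ) /
    ((1 : Submodule (order f) (L f)).toAddSubgroup.relIndex (I ⊔ 1).toAddSubgroup : ℚ)

/-- The family `v` of `n` elements of `L` has orientation `ε = ±1` relative to the natural basis
of `R_f`: the matrix expressing `v` in that basis has determinant of sign `ε`. -/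
def HasOrientation (f : Form n) (v : Fin n → L f) (ε : ℤˣ) : Prop :=
  ∃ C : Matrix (Fin n) (Fin n) ℚ,
    (∀ i, v i = ∑ j, C i j • natBasis f 0 j) ∧ ((ε : ℤ) : ℚ) * C.det > 0

/-- A pair `(I, α)`: an oriented fractional ideal `(I, ε)` of `R_f` (a free abelian subgroup of `L`
of rank `n`, stable under `R_f`, with a sign `ε`), and `α ∈ Lˣ`, with `I² ⊆ α I_f^{n-3}` and
`N(I)² = N(α) / f₀^{n-3}`, where `N(I)` is the signed norm `ε N(I)`. -/
structure IdealPair (f : Form n) where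
  I : Submodule (order f) (L f)
  free : Module.Free ℤ I
  rank : Module.finrank ℤ I = n
  ε : ℤˣ
  α : (L f)ˣ
  sq_le : I * I ≤ α • idealPow f ((n : ℤ) - 3)
  norm_sq : (((ε : ℤ) : ℚ) * idealNorm f I) ^ 2 =
    Algebra.norm ℚ (α : L f) / (f 0 : ℚ) ^ ((n : ℤ) - 3)

/-- `(I*, α*) = (κ I, κ² α)` for some `κ ∈ Lˣ`, where `κ (I, ε) = (κ I, sgn(N κ) ε)`. -/
def IdealPair.Equivalent {f : Form n} (p q : IdealPair f) : Prop :=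
  ∃ κ : (L f)ˣ, q.I = κ • p.I ∧
    (q.ε : ℤ) = (SignType.sign (Algebra.norm ℚ (κ : L f)) : ℤ) * (p.ε : ℤ) ∧
    q.α = κ ^ 2 * p.α

theorem sign_norm_mul_self {f : Form n} (κ : (L f)ˣ) :
    (SignType.sign (Algebra.norm ℚ (κ : L f)) : ℤ) *
      (SignType.sign (Algebra.norm ℚ (κ : L f)) : ℤ) = 1 := by
  have h : Algebra.norm ℚ (κ : L f) ≠ 0 := (κ.isUnit.map (Algebra.norm ℚ)).ne_zero
  rcases lt_or_gt_of_ne h with h | h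
  · rw [sign_neg h]; rfl
  · rw [sign_pos h]; rfl

theorem sign_norm_inv {f : Form n} (κ : (L f)ˣ) :
    (SignType.sign (Algebra.norm ℚ ((κ⁻¹ : (L f)ˣ) : L f)) : ℤ) *
      (SignType.sign (Algebra.norm ℚ (κ : L f)) : ℤ) = 1 := by
  rw [← SignType.coe_mul, ← sign_mul, ← map_mul, Units.inv_mul]
  simp

/-- Equivalence of pairs. -/
def pairSetoid (f : Form n) : Setoid (IdealPair f) where
  r := IdealPair.Equivalent
  iseqv :=
    { refl := fun p => ⟨1, by simp, by simp, by simp⟩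
      symm := by
        rintro p q ⟨κ, hI, hε, hα⟩
        refine ⟨κ⁻¹, by rw [hI, inv_smul_smul], ?_, ?_⟩
        · rw [hε, ← mul_assoc, sign_norm_inv, one_mul]
        · rw [hα, ← mul_assoc, ← mul_pow, inv_mul_cancel, one_pow, one_mul]
      trans := by
        rintro p q r ⟨κ, hI, hε, hα⟩ ⟨μ, hI', hε', hα'⟩
        refine ⟨μ * κ, by rw [hI', hI, mul_smul], ?_, ?_⟩
        · rw [hε', hε, Units.val_mul, map_mul, sign_mul, SignType.coe_mul, mul_assoc]
        · rw [hα', hα, mul_pow, mul_assoc] }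

/-! ### Pairs of symmetric matrices -/

/-- Pairs `(A, B)` of integral symmetric `n × n` matrices. -/
@[ext] structure SymPair (n : ℕ) where
  A : Matrix (Fin n) (Fin n) ℤ
  B : Matrix (Fin n) (Fin n) ℤ
  symmA : A.IsSymm
  symmB : B.IsSymm

/-- The natural action of `SL_n(ℤ)`: `g (A, B) = (g A gᵗ, g B gᵗ)`. -/
instance : MulAction (Matrix.SpecialLinearGroup (Fin n) ℤ) (SymPair n) where
  smul g v :=
    { A := (g : Matrix (Fin n) (Fin n) ℤ) * v.A * (g : Matrix (Fin n) (Fin n) ℤ).transpose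
      B := (g : Matrix (Fin n) (Fin n) ℤ) * v.B * (g : Matrix (Fin n) (Fin n) ℤ).transpose
      symmA := by
        have := v.symmA.eq
        simp [Matrix.IsSymm, Matrix.transpose_mul, this, Matrix.mul_assoc]
      symmB := by
        have := v.symmB.eq
        simp [Matrix.IsSymm, Matrix.transpose_mul, this, Matrix.mul_assoc] }
  one_smul v := by
    apply SymPair.ext
    · change ((1 : Matrix.SpecialLinearGroup (Fin n) ℤ) : Matrix (Fin n) (Fin n) ℤ) * v.A *
        ((1 : Matrix.SpecialLinearGroup (Fin n) ℤ) : Matrix (Fin n) (Fin n) ℤ).transpose = v.A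
      simp
    · change ((1 : Matrix.SpecialLinearGroup (Fin n) ℤ) : Matrix (Fin n) (Fin n) ℤ) * v.B *
        ((1 : Matrix.SpecialLinearGroup (Fin n) ℤ) : Matrix (Fin n) (Fin n) ℤ).transpose = v.B
      simp
  mul_smul g h v := by
    apply SymPair.ext
    · change ((g * h : Matrix.SpecialLinearGroup (Fin n) ℤ) : Matrix (Fin n) (Fin n) ℤ) * v.A *
        ((g * h : Matrix.SpecialLinearGroup (Fin n) ℤ) : Matrix (Fin n) (Fin n) ℤ).transpose =
        (g : Matrix (Fin n) (Fin n) ℤ) * ((h : Matrix (Fin n) (Fin n) ℤ) * v.A *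
          (h : Matrix (Fin n) (Fin n) ℤ).transpose) * (g : Matrix (Fin n) (Fin n) ℤ).transpose
      simp [Matrix.transpose_mul, Matrix.mul_assoc]
    · change ((g * h : Matrix.SpecialLinearGroup (Fin n) ℤ) : Matrix (Fin n) (Fin n) ℤ) * v.B *
        ((g * h : Matrix.SpecialLinearGroup (Fin n) ℤ) : Matrix (Fin n) (Fin n) ℤ).transpose =
        (g : Matrix (Fin n) (Fin n) ℤ) * ((h : Matrix (Fin n) (Fin n) ℤ) * v.B *
          (h : Matrix (Fin n) (Fin n) ℤ).transpose) * (g : Matrix (Fin n) (Fin n) ℤ).transpose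
      simp [Matrix.transpose_mul, Matrix.mul_assoc]

/-- The invariant binary form `disc(xA - yB) = (-1)^{n(n-1)/2} det(xA - yB)`. -/
def SymPair.invariant (v : SymPair n) : MvPolynomial (Fin 2) ℤ :=
  (-1) ^ (n * (n - 1) / 2) *
    Matrix.det ((MvPolynomial.X 0 : MvPolynomial (Fin 2) ℤ) •
        v.A.map (MvPolynomial.C : ℤ →+* MvPolynomial (Fin 2) ℤ) -
      (MvPolynomial.X 1 : MvPolynomial (Fin 2) ℤ) •
        v.B.map (MvPolynomial.C : ℤ →+* MvPolynomial (Fin 2) ℤ))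

/-- The pairs `(A, B)` with invariant form `f`. -/
abbrev WithInvariant (f : Form n) : Type := {v : SymPair n // v.invariant = toPoly f}

/-- Two pairs with invariant form `f` are related if they lie in the same `SL_n(ℤ)`-orbit. -/
def orbitSetoid (f : Form n) : Setoid (WithInvariant f) :=
  (MulAction.orbitRel (Matrix.SpecialLinearGroup (Fin n) ℤ) (SymPair n)).comap Subtype.val

/-- `A` and `B` are the matrices of the coefficients of `ζ_{n-1}` and `ζ_{n-2}`, in the natural
basis of `I_f(n-3)`, of the map `α⁻¹ × : I × I → I_f^{n-3}`, in terms of the `ℤ`-basis `b` of `I`. -/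
def IsGram {f : Form n} (p : IdealPair f) (b : Module.Basis (Fin n) ℤ p.I) (v : SymPair n) :
    Prop :=
  ∀ i j, ∃ c : ℕ → ℤ,
    ((p.α⁻¹ : (L f)ˣ) : L f) * ((b i : L f) * (b j : L f)) =
      ∑ k ∈ Finset.range n, c k • natBasis f ((n : ℤ) - 3) k ∧
    v.A i j = c (n - 1) ∧ v.B i j = c (n - 2)

/-! ### Endomorphism rings and their 2-torsion units of norm one -/

/-- The endomorphism ring `S = {s ∈ L | s I ⊆ I}` of `I` in `L`. -/
def endRing {f : Form n} (I : Submodule (order f) (L f)) : Subring (L f) where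
  carrier := {s | ∀ x ∈ I, s * x ∈ I}
  mul_mem' := fun {a b} ha hb x hx => by
    rw [mul_assoc]
    exact ha _ (hb x hx)
  one_mem' := fun x hx => by rwa [one_mul]
  add_mem' := fun {a b} ha hb x hx => by
    rw [add_mul]
    exact add_mem (ha x hx) (hb x hx)
  zero_mem' := fun x _ => by
    rw [zero_mul]
    exact zero_mem _
  neg_mem' := fun {a} ha x hx => by
    rw [neg_mul]
    exact neg_mem (ha x hx)

/-- The group `S^×[2]_{N=1}` of units `u` of `S` with `u² = 1` and `N(u) = 1`. -/
def twoTorsionNormOne {f : Form n} (S : Subring (L f)) : Subgroup Sˣ where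
  carrier := {u | u ^ 2 = 1 ∧ Algebra.norm ℚ ((u : S) : L f) = 1}
  mul_mem' := fun {a b} ha hb => ⟨by rw [mul_pow, ha.1, hb.1, one_mul], by
    rw [Units.val_mul, Subring.coe_mul, map_mul, ha.2, hb.2, one_mul]⟩
  one_mem' := ⟨one_pow 2, by simp⟩
  inv_mem' := fun {a} ha => by
    have h : a⁻¹ = a := inv_eq_of_mul_eq_one_left (by rw [← pow_two]; exact ha.1)
    rw [h]
    exact ha

end

end BinForm

namespace BinForm

variable {n : ℕ}

/-! ### The power basis of `L` -/

/-! Everything is read through one functional: φ : L → ℚ is 1/f₀ times the coefficient of θⁿ⁻¹. The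
recursion ζ_{k+1} = θ(ζ_k + f_k) shows that the powers θⁱ and the elements ζ_{n-1-i} + f_{n-1-i} are
dual for the form φ(xy) (`phi_theta_pow_mul`), which is therefore nondegenerate. On I_f^{n-3} the
coefficients of ζ_{n-1} and ζ_{n-2} are z ↦ φ(z) and z ↦ φ(θz), and every z with φ(zR_f) and φ(θz)
integral lies in I_f^{n-3} (`mem_natSpan_of_phi_int`). So the matrices attached to (I, α) are A =
φ(b_i b_j/α) and B = φ(θ b_i b_j/α).

From (I, α) to (A, B): sA - tB is the Gram matrix of φ twisted by (s - tθ)/α. Its determinant is N(s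
- tθ)N(α)⁻¹ times the squared determinant of the basis and the explicit determinant of φ(θ^{i+j})
(`det_phi_mul`). As f₀N(s - tθ) = f(s, t), having invariant form f is equivalent to the norm
condition on (I, α) (`invariant_iff`).

From (A, B) to (I, α): S = A⁻¹B has characteristic polynomial f(x,1)/f₀, separable because Δ(f) ≠ 0,
so a cyclic vector identifies ℚⁿ with L and S with multiplication by θ. Both A and AS = B are
symmetric, so θ is self-adjoint for A; hence A is the form φ(βxy) for a unit β, and α = β⁻¹
(`exists_isPhiGram`). The lattice ℤⁿ is stable under R_f since ζ_k + f_k acts by a coefficient of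
±adj(xA - B) times A, an integral matrix (`leftMulMatrix_zeta`). Duality then gives I² ⊆ αI_f^{n-3}.

Uniqueness and stabilizers: a linear map carrying one basis to another with the same (A, B)
preserves both forms, so it commutes with θ and is multiplication by some κ, with α' = κ²α
(`exists_unit_of_isPhiGram`). For two realizations this is the equivalence of pairs; for a
stabilizing g it gives a κ with κ² = 1 and N(κ) = det g = 1. -/

theorem cf_zero (f : Form n) : cf f 0 = f 0 := by simp [cf]

theorem coeff_dehom (f : Form n) {i : ℕ} (h : i ≤ n) : (dehom f).coeff i = cf f (n - i) := by
  simp only [dehom, Polynomial.finsetSum_coeff, Polynomial.coeff_C_mul_X_pow]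
  rw [Finset.sum_eq_single (n - i)]
  · rw [if_pos (by omega)]
  · intro b hb hne
    have := Finset.mem_range.1 hb
    rw [if_neg (by omega)]
  · intro h'
    exact absurd (Finset.mem_range.2 (by omega)) h'

theorem natDegree_dehom_le (f : Form n) : (dehom f).natDegree ≤ n := by
  refine Polynomial.natDegree_sum_le_of_forall_le _ _ fun i _ => ?_
  exact (Polynomial.natDegree_C_mul_X_pow_le _ _).trans (Nat.sub_le _ _)

theorem natDegree_dehom {f : Form n} (hf0 : f 0 ≠ 0) : (dehom f).natDegree = n := by
  refine Polynomial.natDegree_eq_of_le_of_coeff_ne_zero (natDegree_dehom_le f) ?_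
  rwa [coeff_dehom f le_rfl, Nat.sub_self, cf_zero]

theorem natDegree_dehom_map {f : Form n} (hf0 : f 0 ≠ 0) :
    ((dehom f).map (Int.castRingHom ℚ)).natDegree = n := by
  rw [Polynomial.natDegree_map_eq_of_injective (RingHom.injective_int _), natDegree_dehom hf0]

theorem dehom_ne_zero {f : Form n} (hf0 : f 0 ≠ 0) : dehom f ≠ 0 := fun h => hf0 (by
  rw [← cf_zero f, ← Nat.sub_self n, ← coeff_dehom f le_rfl, h, Polynomial.coeff_zero])

theorem dehom_map_ne_zero {f : Form n} (hf0 : f 0 ≠ 0) :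
    (dehom f).map (Int.castRingHom ℚ) ≠ 0 :=
  (Polynomial.map_ne_zero_iff (RingHom.injective_int _)).2 (dehom_ne_zero hf0)

theorem leadingCoeff_dehom_map {f : Form n} (hf0 : f 0 ≠ 0) :
    ((dehom f).map (Int.castRingHom ℚ)).leadingCoeff = (f 0 : ℚ) := by
  rw [Polynomial.leadingCoeff, natDegree_dehom_map hf0, Polynomial.coeff_map, coeff_dehom f le_rfl,
    Nat.sub_self, cf_zero]
  simp

/-- The basis `1, θ, …, θⁿ⁻¹` of `L`. -/
noncomputable def thetaBasis (f : Form n) (hf0 : f 0 ≠ 0) : Module.Basis (Fin n) ℚ (L f) :=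
  (AdjoinRoot.powerBasis (dehom_map_ne_zero hf0)).basis.reindex
    (finCongr (natDegree_dehom_map hf0))

theorem thetaBasis_apply (f : Form n) (hf0 : f 0 ≠ 0) (i : Fin n) :
    thetaBasis f hf0 i = theta f ^ (i : ℕ) := by
  rw [thetaBasis, Module.Basis.reindex_apply, PowerBasis.basis_eq_pow]
  rfl

theorem finiteDimensional_L {f : Form n} (hf0 : f 0 ≠ 0) : FiniteDimensional ℚ (L f) :=
  Module.Finite.of_basis (thetaBasis f hf0)

theorem finrank_L {f : Form n} (hf0 : f 0 ≠ 0) : Module.finrank ℚ (L f) = n := by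
  rw [Module.finrank_eq_card_basis (thetaBasis f hf0), Fintype.card_fin]

theorem repr_theta_pow (f : Form n) (hf0 : f 0 ≠ 0) {k : ℕ} (hk : k < n) (i : Fin n) :
    (thetaBasis f hf0).repr (theta f ^ k) i = if k = i then 1 else 0 := by
  rw [← thetaBasis_apply f hf0 ⟨k, hk⟩, Module.Basis.repr_self, Finsupp.single_apply]
  simp [Fin.ext_iff]

/-- Since θ generates L over ℚ, intertwining θ with T forces intertwining every polynomial in θ with
the same polynomial in T. -/
theorem linearMap_eq_mul_of_commute_theta {f : Form n} {M : Type*} [AddCommGroup M] [Module ℚ M]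
    (T : M →ₗ[ℚ] M) (σ : L f →ₗ[ℚ] M) (h : ∀ x, σ (theta f * x) = T (σ x))
    (p : Polynomial ℚ) (x : L f) :
    σ (AdjoinRoot.mk _ p * x) = Polynomial.aeval T p (σ x) := by
  induction p using Polynomial.induction_on' with
  | add p q hp hq => simp [add_mul, hp, hq]
  | monomial k a =>
    rw [← Polynomial.C_mul_X_pow_eq_monomial]
    induction k with
    | zero =>
      have : (AdjoinRoot.mk ((dehom f).map (Int.castRingHom ℚ)) (Polynomial.C a)) * x = a • x := by
        rw [Algebra.smul_def]; rfl
      simp only [pow_zero, mul_one, this, map_smul, Polynomial.aeval_C]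
      simp
    | succ k ih =>
      have hk : Polynomial.C a * Polynomial.X ^ (k + 1) =
          Polynomial.X * (Polynomial.C a * Polynomial.X ^ k) := by ring
      rw [hk, map_mul (AdjoinRoot.mk _), AdjoinRoot.mk_X, mul_assoc]
      refine (h _).trans ?_
      rw [ih, map_mul (Polynomial.aeval T) Polynomial.X, Polynomial.aeval_X]
      rfl

/-- Commuting with θ amounts to L-linearity, and an L-linear endomorphism of L is determined by its
value at 1. -/
theorem linearMap_eq_mul_one {f : Form n} (σ : L f →ₗ[ℚ] L f)
    (h : ∀ x, σ (theta f * x) = theta f * σ x) (x : L f) : σ x = x * σ 1 := by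
  have key := linearMap_eq_mul_of_commute_theta (LinearMap.mulLeft ℚ (theta f)) σ h
  have key' := linearMap_eq_mul_of_commute_theta (LinearMap.mulLeft ℚ (theta f)) LinearMap.id
    (fun x => rfl)
  obtain ⟨p, rfl⟩ := AdjoinRoot.mk_surjective x
  have h1 := key p 1
  rw [mul_one] at h1
  have h2 := key' p (σ 1)
  simp only [LinearMap.id_apply] at h2
  rw [h1, h2]

/-! ### The functional `φ` -/

/-- The linear functional sending `z` to its coefficient of `ζ_{n-1}` in the natural basis of
`R_f` (equivalently, of any `I_f(k)` with `k < n - 1`). -/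
noncomputable def phi (f : Form n) (hf0 : f 0 ≠ 0) : L f →ₗ[ℚ] ℚ :=
  if h : 0 < n then (f 0 : ℚ)⁻¹ • (thetaBasis f hf0).coord ⟨n - 1, by omega⟩ else 0

theorem phi_theta_pow (f : Form n) (hf0 : f 0 ≠ 0) {k : ℕ} (hk : k < n) :
    phi f hf0 (theta f ^ k) = if k = n - 1 then (f 0 : ℚ)⁻¹ else 0 := by
  rw [phi, dif_pos (by omega), LinearMap.smul_apply, Module.Basis.coord_apply,
    repr_theta_pow f hf0 hk]
  split_ifs <;> simp

theorem zeta_add_cf (f : Form n) (k : ℕ) :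
    zeta f k + (cf f k : L f) = ∑ i ∈ Finset.range (k + 1), (cf f i : L f) * theta f ^ (k - i) := by
  rw [Finset.sum_range_succ, zeta]
  simp

theorem phi_intCast_mul (f : Form n) (hf0 : f 0 ≠ 0) (m : ℤ) (x : L f) :
    phi f hf0 ((m : L f) * x) = m * phi f hf0 x := by
  rw [← zsmul_eq_mul, map_zsmul, zsmul_eq_mul]

theorem phi_zeta_add_cf (f : Form n) (hf0 : f 0 ≠ 0) {m : ℕ} (hm : m ≤ n) :
    phi f hf0 (zeta f m + (cf f m : L f)) = if m + 1 = n then 1 else 0 := by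
  rcases hm.eq_or_lt with rfl | hm
  · rw [zeta_last]; simp
  rw [zeta_add_cf, map_sum, Finset.sum_eq_single 0]
  · rw [phi_intCast_mul, Nat.sub_zero, phi_theta_pow f hf0 hm, cf_zero]
    have : (f 0 : ℚ) ≠ 0 := by exact_mod_cast hf0
    split_ifs <;> first | omega | simp [this]
  · intro i hi h0
    have hi := Finset.mem_range.1 hi
    rw [phi_intCast_mul, phi_theta_pow f hf0 (by omega), if_neg (by omega), mul_zero]
  · simp

/-- The duality on which everything rests. By ζ_{m+1} = θ(ζ_m + f_m), a factor θ is traded for a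
step in m; the error term f_{m+1}θⁱ has degree below n - 1, so φ kills it. -/
theorem phi_theta_pow_mul (f : Form n) (hf0 : f 0 ≠ 0) {i : ℕ} (hi : i < n) :
    ∀ m ≤ n, phi f hf0 (theta f ^ i * (zeta f m + (cf f m : L f))) =
      if i + m + 1 = n then 1 else 0 := by
  induction i with
  | zero => intro m hm; rw [pow_zero, one_mul, phi_zeta_add_cf f hf0 hm]; simp
  | succ i ih =>
    intro m hm
    rcases hm.eq_or_lt with rfl | hm
    -- At m = n the recursion stops, but ζ_n + f_n = f(θ, 1) = 0.
    · rw [zeta_last, neg_add_cancel, mul_zero, map_zero, if_neg]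
      omega
    have : theta f ^ (i + 1) * (zeta f m + (cf f m : L f)) =
        theta f ^ i * (zeta f (m + 1) + (cf f (m + 1) : L f)) -
          (cf f (m + 1) : L f) * theta f ^ i := by
      rw [zeta_succ]; ring
    rw [this, map_sub, ih (by omega) _ hm, phi_intCast_mul, phi_theta_pow f hf0 (by omega),
      if_neg (by omega : ¬ i = n - 1)]
    simp only [mul_zero, sub_zero]
    congr 1
    simp; omega

theorem phi_sum_theta_pow_mul (f : Form n) (hf0 : f 0 ≠ 0) (s : Finset ℕ) (hs : ∀ i ∈ s, i < n)
    (c : ℕ → ℚ) {k : ℕ} (hk : k ∈ s) :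
    phi f hf0 ((∑ i ∈ s, c i • theta f ^ i) *
      (zeta f (n - 1 - k) + (cf f (n - 1 - k) : L f))) = c k := by
  have hk' := hs k hk
  rw [Finset.sum_mul, map_sum, Finset.sum_eq_single k]
  · rw [smul_mul_assoc, map_smul, phi_theta_pow_mul f hf0 hk' _ (by omega), if_pos (by omega)]
    simp
  · intro i hi hne
    have := hs i hi
    rw [smul_mul_assoc, map_smul, phi_theta_pow_mul f hf0 this _ (by omega), if_neg (by omega)]
    simp
  · exact fun h => absurd hk h

theorem exists_sum_theta_pow (f : Form n) (hf0 : f 0 ≠ 0) (z : L f) :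
    ∃ c : ℕ → ℚ, z = ∑ i ∈ Finset.range n, c i • theta f ^ i := by
  refine ⟨fun i => if h : i < n then (thetaBasis f hf0).repr z ⟨i, h⟩ else 0, ?_⟩
  rw [Finset.sum_range]
  conv_lhs => rw [← (thetaBasis f hf0).sum_repr z]
  refine Finset.sum_congr rfl fun i _ => ?_
  simp only [thetaBasis_apply, dif_pos i.2]

theorem eq_zero_of_phi_mul_eq_zero (f : Form n) (hf0 : f 0 ≠ 0) {z : L f}
    (h : ∀ w, phi f hf0 (z * w) = 0) : z = 0 := by
  obtain ⟨c, rfl⟩ := exists_sum_theta_pow f hf0 z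
  refine Finset.sum_eq_zero fun k hk => ?_
  rw [← phi_sum_theta_pow_mul f hf0 _ (fun i hi => Finset.mem_range.1 hi) c hk, h, zero_smul]

/-- Nondegeneracy of φ(xy) embeds L in its dual, and the dimensions agree. -/
theorem exists_eq_phi_mul (f : Form n) (hf0 : f 0 ≠ 0) (l : L f →ₗ[ℚ] ℚ) :
    ∃ b : L f, ∀ z, l z = phi f hf0 (b * z) := by
  have := finiteDimensional_L hf0
  let Φ : L f →ₗ[ℚ] (L f →ₗ[ℚ] ℚ) := (LinearMap.mul ℚ (L f)).compr₂ (phi f hf0)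
  have hinj : Function.Injective Φ := by
    rw [← LinearMap.ker_eq_bot, LinearMap.ker_eq_bot']
    intro m hm
    exact eq_zero_of_phi_mul_eq_zero f hf0 fun w => by
      simpa [Φ] using LinearMap.congr_fun hm w
  have hsurj : Function.Surjective Φ :=
    (LinearMap.injective_iff_surjective_of_finrank_eq_finrank
      (Subspace.dual_finrank_eq (K := ℚ) (V := L f)).symm).1 hinj
  obtain ⟨b, hb⟩ := hsurj l
  exact ⟨b, fun z => by rw [← hb]; simp [Φ]⟩

/-! ### Natural bases in terms of the power basis -/

theorem zeta_zero (f : Form n) : zeta f 0 = 0 := by simp [zeta]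

theorem repr_intCast_mul (f : Form n) (hf0 : f 0 ≠ 0) (m : ℤ) (x : L f) (i : Fin n) :
    (thetaBasis f hf0).repr ((m : L f) * x) i = m * (thetaBasis f hf0).repr x i := by
  rw [← zsmul_eq_mul, map_zsmul, Finsupp.smul_apply, zsmul_eq_mul]

theorem repr_zeta_add_cf (f : Form n) (hf0 : f 0 ≠ 0) {k : ℕ} (hk : k < n) (i : Fin n) :
    (thetaBasis f hf0).repr (zeta f k + (cf f k : L f)) i =
      if (i : ℕ) ≤ k then (cf f (k - i) : ℚ) else 0 := by
  rw [zeta_add_cf, map_sum, Finsupp.finsetSum_apply]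
  have h : ∀ m ∈ Finset.range (k + 1),
      (thetaBasis f hf0).repr ((cf f m : L f) * theta f ^ (k - m)) i =
        if k - m = i then (cf f m : ℚ) else 0 := fun m hm => by
    rw [repr_intCast_mul, repr_theta_pow f hf0 (by omega)]
    simp
  rw [Finset.sum_congr rfl h]
  split_ifs with hik
  · rw [Finset.sum_eq_single (k - (i : ℕ))]
    · rw [if_pos (by omega)]
    · intro m hm hne
      have := Finset.mem_range.1 hm
      rw [if_neg (by omega)]
    · intro h'
      exact absurd (Finset.mem_range.2 (by omega)) h'
  · refine Finset.sum_eq_zero fun m hm => if_neg (by omega)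

/-- The natural basis is triangular over the powers of θ, with diagonal entries 1 (powers of θ) or
f₀ (the ζ's), so its determinant is a power of f₀. -/
theorem repr_natBasis_of_le (f : Form n) (hf0 : f 0 ≠ 0) (k : ℤ) {i j : Fin n} (hji : j ≤ i) :
    (thetaBasis f hf0).repr (natBasis f k j) i =
      if j = i then (if 0 ≤ k ∧ (j : ℤ) ≤ k then 1 else (f 0 : ℚ)) else 0 := by
  have key : (thetaBasis f hf0).repr (zeta f j + (cf f j : L f)) i =
      if j = i then (f 0 : ℚ) else 0 := by
    rw [repr_zeta_add_cf f hf0 j.2]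
    rcases hji.eq_or_lt with rfl | hlt
    · simp [cf_zero]
    · rw [if_neg (by simpa using hlt), if_neg hlt.ne]
  unfold natBasis
  by_cases hk : k < 0
  · rw [if_pos hk, key]
    simp [hk.not_ge]
  rw [if_neg hk]
  by_cases hj : (j : ℤ) ≤ k
  · rw [if_pos hj, repr_theta_pow f hf0 j.2]
    simp [hj, not_lt.1 hk, Fin.ext_iff]
  · rw [if_neg hj]
    have h1 : zeta f j = (zeta f j + (cf f j : L f)) - (cf f j : L f) * theta f ^ 0 := by simp
    have hi : ¬ 0 = (i : ℕ) := by
      have : (j : ℕ) ≤ i := hji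
      omega
    rw [h1, map_sub, Finsupp.sub_apply, key, repr_intCast_mul, repr_theta_pow f hf0 (by omega),
      if_neg hi]
    simp [hj]

theorem det_natBasis (f : Form n) (hf0 : f 0 ≠ 0) (k : ℤ) :
    (thetaBasis f hf0).det (fun j : Fin n => natBasis f k j) =
      ∏ j : Fin n, if 0 ≤ k ∧ (j : ℤ) ≤ k then 1 else (f 0 : ℚ) := by
  rw [Module.Basis.det_apply, Matrix.det_of_isUpperTriangular]
  · refine Finset.prod_congr rfl fun j _ => ?_
    rw [Module.Basis.toMatrix_apply, repr_natBasis_of_le f hf0 k le_rfl, if_pos rfl]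
  · intro i j hij
    have hij : j < i := hij
    rw [Module.Basis.toMatrix_apply, repr_natBasis_of_le f hf0 k hij.le, if_neg hij.ne]

theorem det_natBasis_eq_pow (f : Form n) (hf0 : f 0 ≠ 0) (k : ℤ) :
    (thetaBasis f hf0).det (fun j : Fin n => natBasis f k j) =
      (f 0 : ℚ) ^ (n - (k + 1).toNat) := by
  rw [det_natBasis, Finset.prod_ite, Finset.prod_const_one, one_mul, Finset.prod_const]
  congr 1
  have : (Finset.univ.filter fun j : Fin n => ¬ (0 ≤ k ∧ (j : ℤ) ≤ k)) =
      Finset.univ.filter fun j : Fin n => ¬ ((j : ℕ) < (k + 1).toNat) := by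
    refine Finset.filter_congr fun j _ => ?_
    omega
  rw [this, Finset.filter_not, Finset.card_sdiff_of_subset (Finset.filter_subset _ _),
    Finset.card_univ, Fintype.card_fin, Fin.card_filter_val_lt]
  omega

theorem natBasis_isBasis (f : Form n) (hf0 : f 0 ≠ 0) (k : ℤ) :
    LinearIndependent ℚ (fun j : Fin n => natBasis f k j) ∧
      Submodule.span ℚ (Set.range fun j : Fin n => natBasis f k j) = ⊤ := by
  rw [Module.Basis.is_basis_iff_det (thetaBasis f hf0), det_natBasis, isUnit_iff_ne_zero,
    Finset.prod_ne_zero_iff]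
  intro j _
  have : (f 0 : ℚ) ≠ 0 := by exact_mod_cast hf0
  split_ifs <;> simp [this]

/-- The natural basis of `I_f(k)`, as a `ℚ`-basis of `L`. -/
noncomputable def natBasisQ (f : Form n) (hf0 : f 0 ≠ 0) (k : ℤ) : Module.Basis (Fin n) ℚ (L f) :=
  Module.Basis.mk (natBasis_isBasis f hf0 k).1 (natBasis_isBasis f hf0 k).2.ge

@[simp] theorem coe_natBasisQ (f : Form n) (hf0 : f 0 ≠ 0) (k : ℤ) :
    ⇑(natBasisQ f hf0 k) = fun j : Fin n => natBasis f k j :=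
  Module.Basis.coe_mk _ _

theorem det_thetaBasis_eq (f : Form n) (hf0 : f 0 ≠ 0)
    (b : Module.Basis (Fin n) ℚ (L f)) :
    (thetaBasis f hf0).det b = (f 0 : ℚ) ^ (n - 1) * (natBasisQ f hf0 0).det b := by
  rw [← Module.Basis.det_mul_det _ (natBasisQ f hf0 0) b, coe_natBasisQ,
    det_natBasis_eq_pow f hf0 0]
  rfl

/-! ### Orientation and norm through determinants -/

theorem hasOrientation_iff (f : Form n) (hf0 : f 0 ≠ 0) (v : Fin n → L f) (ε : ℤˣ) :
    HasOrientation f v ε ↔ 0 < ((ε : ℤ) : ℚ) * (natBasisQ f hf0 0).det v := by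
  constructor
  · rintro ⟨C, hC, hpos⟩
    have : (natBasisQ f hf0 0).toMatrix v = C.transpose := by
      ext i j
      rw [Module.Basis.toMatrix_apply, hC j]
      have h : ∑ k : Fin n, C j k • natBasis f 0 k = ∑ k, C j k • natBasisQ f hf0 0 k := by
        rw [coe_natBasisQ]
      rw [h, Module.Basis.repr_sum_self]
      rfl
    rw [Module.Basis.det_apply, this, Matrix.det_transpose]
    exact hpos
  · intro h
    refine ⟨((natBasisQ f hf0 0).toMatrix v).transpose, fun i => ?_, ?_⟩
    · conv_lhs => rw [← (natBasisQ f hf0 0).sum_toMatrix_smul_self v i]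
      simp only [coe_natBasisQ, Matrix.transpose_apply]
    · rwa [Matrix.det_transpose, ← Module.Basis.det_apply]

/-- A finitely generated subgroup of a ℚ-space is free, and its ℤ-basis is a ℚ-basis of its span. It
is needed for the lattice I + R_f in the definition of the norm. -/
theorem exists_basis_of_fg (f : Form n) (hf0 : f 0 ≠ 0) (M : Submodule ℤ (L f)) (hfg : M.FG)
    (b : Module.Basis (Fin n) ℚ (L f)) (hb : ∀ i, b i ∈ M) :
    ∃ m : Module.Basis (Fin n) ℚ (L f), M = Submodule.span ℤ (Set.range m) := by
  have : Module.Finite ℤ M := Module.Finite.iff_fg.2 hfg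
  have : Module.IsTorsionFree ℤ (L f) := .trans_faithfulSMul ℤ ℚ (L f)
  have : Module.Free ℤ M := inferInstance
  let b0 := Module.finBasis ℤ M
  have hspan : Submodule.span ℤ (Set.range fun i => (b0 i : L f)) = M := by
    have h := congrArg (Submodule.map M.subtype) b0.span_eq
    rw [Submodule.map_span, ← Set.range_comp, Submodule.map_subtype_top] at h
    exact h
  have hli : LinearIndependent ℚ fun i => (b0 i : L f) :=
    (LinearIndependent.iff_fractionRing ℤ ℚ).1
      (b0.linearIndependent.map' M.subtype (Submodule.ker_subtype M))
  have htop : ⊤ ≤ Submodule.span ℚ (Set.range fun i => (b0 i : L f)) := by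
    rw [← b.span_eq, Submodule.span_le]
    rintro _ ⟨i, rfl⟩
    have h := hb i
    rw [← hspan] at h
    exact Submodule.span_subset_span ℤ ℚ _ h
  let m := Module.Basis.mk hli htop
  have hcard : Module.finrank ℤ M = n := by
    rw [← Fintype.card_fin (Module.finrank ℤ M), ← Module.finrank_eq_card_basis m, finrank_L hf0]
  refine ⟨m.reindex (finCongr hcard), ?_⟩
  rw [Module.Basis.range_reindex, Module.Basis.coe_mk, hspan]

theorem toAddSubgroup_eq_closure {f : Form n} {I : Submodule (order f) (L f)} {s : Set (L f)}
    (h : I.restrictScalars ℤ = Submodule.span ℤ s) : I.toAddSubgroup = AddSubgroup.closure s := by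
  have := congrArg Submodule.toAddSubgroup h
  rw [Submodule.span_int_eq_addSubgroupClosure] at this
  exact this

theorem ringSpan_eq_span (f : Form n) (hn : 0 < n) :
    ringSpan f = Submodule.span ℤ (Set.range fun j : Fin n => natBasis f 0 j) := by
  unfold ringSpan
  congr 1
  ext x
  constructor
  · rintro (rfl | ⟨k, ⟨h1, h2⟩, rfl⟩)
    · exact ⟨⟨0, hn⟩, by simp [natBasis]⟩
    · refine ⟨⟨k, h2⟩, ?_⟩
      simp only [natBasis, lt_self_iff_false, if_false]
      rw [if_neg (by omega)]
  · rintro ⟨j, rfl⟩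
    simp only [natBasis, lt_self_iff_false, if_false]
    split_ifs with h
    · left
      have : (j : ℕ) = 0 := by omega
      rw [this, pow_zero]
    · right
      exact ⟨j, ⟨by omega, j.2⟩, rfl⟩

theorem mem_one_iff (f : Form n) (x : L f) :
    x ∈ (1 : Submodule (order f) (L f)) ↔ x ∈ ringSpan f := by
  rw [Submodule.mem_one]
  exact ⟨fun ⟨y, hy⟩ => hy ▸ y.2, fun h => ⟨⟨x, h⟩, rfl⟩⟩

theorem one_restrictScalars (f : Form n) :
    (1 : Submodule (order f) (L f)).restrictScalars ℤ = ringSpan f := by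
  ext x
  exact mem_one_iff f x

/-- Both indices in I + R_f are absolute values of determinants in a basis of I + R_f; their
quotient is the determinant of the change of basis from R_f to I. -/
theorem idealNorm_eq (f : Form n) (hf0 : f 0 ≠ 0) (hn : 0 < n) (I : Submodule (order f) (L f))
    (b : Module.Basis (Fin n) ℚ (L f)) (hb : I.restrictScalars ℤ = Submodule.span ℤ (Set.range b)) :
    idealNorm f I = |(natBasisQ f hf0 0).det b| := by
  have h1 := (one_restrictScalars f).trans (ringSpan_eq_span f hn)
  have hsup : (I ⊔ 1).restrictScalars ℤ =
      Submodule.span ℤ (Set.range b ∪ Set.range fun j : Fin n => natBasis f 0 j) := by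
    rw [Submodule.span_union, ← hb, ← h1]
    ext x
    simp only [Submodule.restrictScalars_mem, Submodule.mem_sup]
  obtain ⟨m, hm⟩ := exists_basis_of_fg f hf0 ((I ⊔ 1).restrictScalars ℤ)
    (hsup ▸ Submodule.fg_span ((Set.finite_range _).union (Set.finite_range _))) b
    (fun i => hsup ▸ Submodule.subset_span (Or.inl ⟨i, rfl⟩))
  have hI := AddSubgroup.relIndex_eq_abs_det I.toAddSubgroup (I ⊔ 1).toAddSubgroup
    (fun x hx => (le_sup_left : I ≤ I ⊔ 1) hx) b m
    (toAddSubgroup_eq_closure hb) (toAddSubgroup_eq_closure hm)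
  have hR := AddSubgroup.relIndex_eq_abs_det (1 : Submodule (order f) (L f)).toAddSubgroup
    (I ⊔ 1).toAddSubgroup (fun x hx => (le_sup_right : 1 ≤ I ⊔ 1) hx) (natBasisQ f hf0 0) m
    (by rw [coe_natBasisQ]; exact toAddSubgroup_eq_closure h1) (toAddSubgroup_eq_closure hm)
  rw [idealNorm, hI, hR, div_eq_iff (abs_ne_zero.2 (m.isUnit_det _).ne_zero), ← abs_mul, mul_comm,
    Module.Basis.det_mul_det]

/-! ### The ideals `I_f(k)` are powers of `I_f` -/

/-- I_f is generated by 1 and θ, so I_f^{k+1} = I_f^k + θI_f^k; this drives the induction in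
`natSpan_eq_pow`. -/
theorem mem_idealOne_pow_succ (f : Form n) (k : ℕ) (x : L f) :
    x ∈ idealOne f ^ (k + 1) ↔
      ∃ a ∈ idealOne f ^ k, ∃ b ∈ idealOne f ^ k, a + theta f * b = x := by
  rw [pow_succ, idealOne, Submodule.span_insert, Submodule.mul_sup, Submodule.mem_sup]
  simp only [Submodule.mem_mul_span_singleton]
  constructor
  · rintro ⟨_, ⟨a, ha, rfl⟩, _, ⟨b, hb, rfl⟩, rfl⟩
    exact ⟨a, ha, b, hb, by ring⟩
  · rintro ⟨a, ha, b, hb, rfl⟩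
    exact ⟨_, ⟨a, ha, rfl⟩, _, ⟨b, hb, rfl⟩, by ring⟩

/-- The `ℤ`-span of the natural basis of `I_f(k)`. -/
noncomputable def natSpan (f : Form n) (k : ℤ) : Submodule ℤ (L f) :=
  Submodule.span ℤ (Set.range fun i : Fin n => natBasis f k i)

theorem intCast_mul_mem {f : Form n} (M : Submodule ℤ (L f)) (m : ℤ) {x : L f} (hx : x ∈ M) :
    (m : L f) * x ∈ M := by
  rw [← zsmul_eq_mul]
  exact M.smul_mem m hx

theorem theta_pow_mem_natSpan (f : Form n) {k j : ℕ} (hj : j ≤ k) (hk : k < n) :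
    theta f ^ j ∈ natSpan f k := by
  refine Submodule.subset_span ⟨⟨j, by omega⟩, ?_⟩
  simp only [natBasis]
  rw [if_neg (by omega), if_pos (by omega)]

theorem zeta_mem_natSpan (f : Form n) {k j : ℕ} (hj : j ≤ n) (hk : k < n) :
    zeta f j ∈ natSpan f k := by
  rcases le_or_gt j k with h | h
  · refine Submodule.sum_mem _ fun i _ => ?_
    exact intCast_mul_mem _ _ (theta_pow_mem_natSpan f (by omega) hk)
  rcases hj.eq_or_lt with rfl | hj
  · rw [zeta_last, ← Int.cast_neg, ← mul_one ((_ : ℤ) : L f), ← pow_zero (theta f)]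
    exact intCast_mul_mem _ _ (theta_pow_mem_natSpan f (by omega) hk)
  · refine Submodule.subset_span ⟨⟨j, hj⟩, ?_⟩
    simp only [natBasis]
    rw [if_neg (by omega), if_neg (by omega)]

theorem natSpan_le (f : Form n) {k : ℕ} {M : Submodule ℤ (L f)}
    (h1 : ∀ j ≤ k, theta f ^ j ∈ M) (h2 : ∀ j, k < j → j < n → zeta f j ∈ M) :
    natSpan f k ≤ M := by
  refine Submodule.span_le.2 ?_
  rintro _ ⟨j, rfl⟩
  simp only [natBasis]
  rw [if_neg (by omega)]
  split_ifs with h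
  · exact h1 _ (by omega)
  · exact h2 _ (by omega) j.2

theorem natSpan_eq_pow (f : Form n) {k : ℕ} (hk : k < n) :
    natSpan f k = (idealOne f ^ k).restrictScalars ℤ := by
  induction k with
  | zero =>
    rw [pow_zero, one_restrictScalars, ringSpan_eq_span f hk]
    rfl
  | succ k ih =>
    have ih := ih (by omega)
    have hmem : ∀ x, x ∈ idealOne f ^ k ↔ x ∈ natSpan f k := fun x => by rw [ih]; rfl
    apply le_antisymm
    · refine natSpan_le f (fun j hj => ?_) (fun j hkj hj => ?_)
      · rw [Submodule.restrictScalars_mem, mem_idealOne_pow_succ]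
        rcases j with _ | j
        · exact ⟨1, (hmem _).2 (pow_zero (theta f) ▸ theta_pow_mem_natSpan f (Nat.zero_le _)
            (by omega)), 0, zero_mem _, by simp⟩
        · exact ⟨0, zero_mem _, _, (hmem _).2 (theta_pow_mem_natSpan f (j := j) (by omega)
            (by omega)), by rw [pow_succ']; ring⟩
      · rw [Submodule.restrictScalars_mem, mem_idealOne_pow_succ]
        exact ⟨_, (hmem _).2 (zeta_mem_natSpan f hj.le (by omega)), 0, zero_mem _, by simp⟩
    · intro x hx
      rw [Submodule.restrictScalars_mem, mem_idealOne_pow_succ] at hx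
      obtain ⟨a, ha, b, hb, rfl⟩ := hx
      rw [hmem] at ha hb
      refine add_mem ?_ ?_
      · refine natSpan_le f (M := natSpan f (k + 1 : ℕ)) (fun j hj => ?_) (fun j hkj hj => ?_) ha
        · exact theta_pow_mem_natSpan f (by omega) hk
        · exact zeta_mem_natSpan f hj.le hk
      · refine natSpan_le f (M := (natSpan f (k + 1 : ℕ)).comap (LinearMap.mulLeft ℤ (theta f)))
          (fun j hj => ?_) (fun j hkj hj => ?_) hb
        · change theta f * theta f ^ j ∈ natSpan f (k + 1 : ℕ)
          rw [← pow_succ']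
          exact theta_pow_mem_natSpan f (by omega) hk
        · change theta f * zeta f j ∈ natSpan f (k + 1 : ℕ)
          -- The correction f_jθ is available because k + 1 ≥ 1.
          have : theta f * zeta f j = zeta f (j + 1) - (cf f j : L f) * theta f ^ 1 := by
            rw [zeta_succ]; ring
          rw [this]
          exact sub_mem (zeta_mem_natSpan f hj hk)
            (intCast_mul_mem _ _ (theta_pow_mem_natSpan f (by omega) hk))

/-! ### The ideal `I_f(n-3)` is the dual of `I_f` under `φ` -/

theorem phi_one (f : Form n) (hf0 : f 0 ≠ 0) (hn : 2 ≤ n) : phi f hf0 1 = 0 := by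
  rw [← pow_zero (theta f), phi_theta_pow f hf0 (by omega), if_neg (by omega)]

theorem phi_zeta (f : Form n) (hf0 : f 0 ≠ 0) (hn : 2 ≤ n) {k : ℕ} (hk : k ≤ n) :
    phi f hf0 (zeta f k) = if k + 1 = n then 1 else 0 := by
  have h := phi_zeta_add_cf f hf0 hk
  rw [← mul_one (cf f k : L f), map_add, phi_intCast_mul, phi_one f hf0 hn] at h
  simpa using h

theorem natBasis_top (f : Form n) (hn : 2 ≤ n) {k : ℕ} (hk : n ≤ k + 2) :
    natBasis f ((n : ℤ) - 3) k = zeta f k ∧ 3 ≤ n ∨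
      natBasis f ((n : ℤ) - 3) k = zeta f k + (cf f k : L f) ∧ n = 2 := by
  unfold natBasis
  rcases hn.eq_or_lt with rfl | hn
  · right; simp
  · left
    rw [if_neg (by omega), if_neg (by omega)]
    exact ⟨rfl, hn⟩

theorem natBasis_low (f : Form n) {k : ℕ} (hk : k + 2 < n) :
    natBasis f ((n : ℤ) - 3) k = theta f ^ k := by
  unfold natBasis
  rw [if_neg (by omega), if_pos (by omega)]

theorem natBasis_top_mem_ringSpan (f : Form n) (hn : 2 ≤ n) {k : ℕ} (hk : n ≤ k + 2)
    (hk' : k ≤ n) : natBasis f ((n : ℤ) - 3) k ∈ ringSpan f := by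
  rcases natBasis_top f hn hk with ⟨h, _⟩ | ⟨h, _⟩
  · rw [h]
    exact zeta_mem_ringSpan f hk'
  · rw [h]
    exact add_mem (zeta_mem_ringSpan f hk') (intCast_mem_ringSpan f _)

theorem phi_natBasis (f : Form n) (hf0 : f 0 ≠ 0) (hn : 2 ≤ n) {k : ℕ} (hk : k < n) :
    phi f hf0 (natBasis f ((n : ℤ) - 3) k) = if k = n - 1 then 1 else 0 := by
  rcases le_or_gt n (k + 2) with h | h
  · rcases natBasis_top f hn h with ⟨h', _⟩ | ⟨h', _⟩
    · rw [h', phi_zeta f hf0 hn hk.le]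
      congr 1
      simp; omega
    · rw [h', phi_zeta_add_cf f hf0 hk.le]
      congr 1
      simp; omega
  · rw [natBasis_low f h, phi_theta_pow f hf0 hk, if_neg (by omega), if_neg (by omega)]

theorem phi_theta_mul_natBasis (f : Form n) (hf0 : f 0 ≠ 0) (hn : 2 ≤ n) {k : ℕ} (hk : k < n) :
    phi f hf0 (theta f * natBasis f ((n : ℤ) - 3) k) = if k = n - 2 then 1 else 0 := by
  have key : phi f hf0 (theta f * (zeta f k + (cf f k : L f))) = if k = n - 2 then 1 else 0 := by
    have := phi_theta_pow_mul f hf0 (i := 1) (by omega) k hk.le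
    rw [pow_one] at this
    rw [this]
    congr 1
    simp; omega
  rcases le_or_gt n (k + 2) with h | h
  · rcases natBasis_top f hn h with ⟨h', h3⟩ | ⟨h', _⟩
    · have : theta f * zeta f k =
          theta f * (zeta f k + (cf f k : L f)) - (cf f k : L f) * theta f ^ 1 := by ring
      rw [h', this, map_sub, key, phi_intCast_mul, phi_theta_pow f hf0 (by omega),
        if_neg (by omega : ¬ 1 = n - 1)]
      simp
    · rw [h', key]
  · rw [natBasis_low f h, ← pow_succ', phi_theta_pow f hf0 (by omega), if_neg (by omega),
      if_neg (by omega)]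

theorem phi_sum_natBasis (f : Form n) (hf0 : f 0 ≠ 0) (hn : 2 ≤ n) (c : ℕ → ℚ) :
    phi f hf0 (∑ k ∈ Finset.range n, c k • natBasis f ((n : ℤ) - 3) k) = c (n - 1) ∧
    phi f hf0 (theta f * ∑ k ∈ Finset.range n, c k • natBasis f ((n : ℤ) - 3) k) = c (n - 2) := by
  constructor
  · rw [map_sum, Finset.sum_eq_single (n - 1)]
    · rw [map_smul, phi_natBasis f hf0 hn (by omega)]; simp
    · intro k hk hne
      rw [map_smul, phi_natBasis f hf0 hn (Finset.mem_range.1 hk), if_neg hne, smul_zero]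
    · intro h
      exact absurd (Finset.mem_range.2 (by omega)) h
  · rw [Finset.mul_sum, map_sum, Finset.sum_eq_single (n - 2)]
    · rw [mul_smul_comm, map_smul, phi_theta_mul_natBasis f hf0 hn (by omega)]; simp
    · intro k hk hne
      rw [mul_smul_comm, map_smul, phi_theta_mul_natBasis f hf0 hn (Finset.mem_range.1 hk),
        if_neg hne, smul_zero]
    · intro h
      exact absurd (Finset.mem_range.2 (by omega)) h

theorem phi_mem_int_of_mem_ringSpan (f : Form n) (hf0 : f 0 ≠ 0) (hn : 2 ≤ n) {x : L f}
    (hx : x ∈ ringSpan f) : ∃ m : ℤ, phi f hf0 x = m := by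
  unfold ringSpan at hx
  induction hx using Submodule.span_induction with
  | mem x h =>
    rcases h with rfl | ⟨k, hk, rfl⟩
    · exact ⟨0, by rw [phi_one f hf0 hn]; simp⟩
    · rw [phi_zeta f hf0 hn hk.2.le]
      split_ifs
      · exact ⟨1, by simp⟩
      · exact ⟨0, by simp⟩
  | zero => exact ⟨0, by simp⟩
  | add x y _ _ hx hy =>
    obtain ⟨a, ha⟩ := hx
    obtain ⟨b, hb⟩ := hy
    exact ⟨a + b, by rw [map_add, ha, hb]; push_cast; rfl⟩
  | smul a x _ hx =>
    obtain ⟨b, hb⟩ := hx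
    exact ⟨a * b, by rw [zsmul_eq_mul, phi_intCast_mul, hb]; push_cast; rfl⟩

/-- An element pairing integrally with `I_f` lies in `I_f(n-3)`. -/
theorem mem_natSpan_of_phi_int (f : Form n) (hf0 : f 0 ≠ 0) (hn : 2 ≤ n) {z : L f}
    (h0 : ∀ w ∈ ringSpan f, ∃ m : ℤ, phi f hf0 (z * w) = m)
    (h1 : ∃ m : ℤ, phi f hf0 (theta f * z) = m) : z ∈ natSpan f ((n : ℤ) - 3) := by
  obtain ⟨c, hc⟩ : ∃ c : ℕ → ℚ, z = ∑ k ∈ Finset.range n, c k • natBasis f ((n : ℤ) - 3) k := by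
    refine ⟨fun i => if h : i < n then (natBasisQ f hf0 (n - 3)).repr z ⟨i, h⟩ else 0, ?_⟩
    rw [Finset.sum_range]
    conv_lhs => rw [← (natBasisQ f hf0 (n - 3)).sum_repr z]
    simp
  obtain ⟨hc1, hc2⟩ := phi_sum_natBasis f hf0 hn c
  rw [← hc] at hc1 hc2
  -- The two top coefficients are φ(z) and φ(θz), integral by hypothesis.
  have htop : ∀ k ∈ Finset.Ico (n - 2) n, ∃ m : ℤ, c k = m := by
    intro k hk
    have hk := Finset.mem_Ico.1 hk
    obtain rfl | rfl : k = n - 1 ∨ k = n - 2 := by omega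
    · rw [← hc1, ← mul_one z]
      exact h0 1 (one_mem_ringSpan f)
    · rw [← hc2]
      exact h1
  have hsplit : z = ∑ k ∈ Finset.range (n - 2), c k • theta f ^ k +
      ∑ k ∈ Finset.Ico (n - 2) n, c k • natBasis f ((n : ℤ) - 3) k := by
    rw [hc, ← Finset.sum_range_add_sum_Ico _ (by omega : n - 2 ≤ n)]
    congr 1
    refine Finset.sum_congr rfl fun k hk => ?_
    rw [natBasis_low f (by have := Finset.mem_range.1 hk; omega)]
  -- The top part of z is now known to lie in R_f, so subtracting it keeps φ integral on products
  -- with R_f.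
  have htopint : ∀ w ∈ ringSpan f, ∃ m : ℤ,
      phi f hf0 ((∑ k ∈ Finset.Ico (n - 2) n, c k • natBasis f ((n : ℤ) - 3) k) * w) = m := by
    intro w hw
    refine phi_mem_int_of_mem_ringSpan f hf0 hn (ringSpan_mul_mem f _ _ ?_ hw)
    refine Submodule.sum_mem _ fun k hk => ?_
    obtain ⟨m, hm⟩ := htop k hk
    have hk := Finset.mem_Ico.1 hk
    rw [hm, Int.cast_smul_eq_zsmul]
    exact Submodule.smul_mem _ _ (natBasis_top_mem_ringSpan f hn (by omega) hk.2.le)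
  -- What remains is a polynomial in θ, whose coefficient of θᵏ is its pairing with the dual element
  -- ζ_{n-1-k} + f_{n-1-k} of R_f.
  have hlow : ∀ k ∈ Finset.range (n - 2), ∃ m : ℤ, c k = m := by
    intro k hk
    have hw : zeta f (n - 1 - k) + (cf f (n - 1 - k) : L f) ∈ ringSpan f :=
      add_mem (zeta_mem_ringSpan f (by omega)) (intCast_mem_ringSpan f _)
    obtain ⟨a, ha⟩ := h0 _ hw
    obtain ⟨b, hb⟩ := htopint _ hw
    refine ⟨a - b, ?_⟩
    rw [← phi_sum_theta_pow_mul f hf0 _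
      (fun i hi => by have := Finset.mem_range.1 hi; omega) c hk]
    push_cast
    rw [← ha, ← hb, ← map_sub, ← sub_mul]
    conv_rhs => rw [hsplit]
    rw [add_sub_cancel_right]
  rw [hc]
  refine Submodule.sum_mem _ fun k hk => ?_
  have hk := Finset.mem_range.1 hk
  obtain ⟨m, hm⟩ : ∃ m : ℤ, c k = m := by
    rcases lt_or_ge k (n - 2) with h | h
    · exact hlow k (Finset.mem_range.2 h)
    · exact htop k (Finset.mem_Ico.2 ⟨h, hk⟩)
  rw [hm, Int.cast_smul_eq_zsmul]
  exact Submodule.smul_mem _ _ (Submodule.subset_span ⟨⟨k, hk⟩, rfl⟩)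

/-- For n ≥ 3 this is an instance of `natSpan_eq_pow`. For n = 2 the exponent is -1: the basis
elements multiply θ into R_f by θ(ζ_j + f_j) = ζ_{j+1}, and conversely zI_f ⊆ R_f makes φ(zR_f) and
φ(θz) integral, so duality applies. -/
theorem natSpan_eq_idealPow (f : Form n) (hf0 : f 0 ≠ 0) (hn : 2 ≤ n) :
    natSpan f ((n : ℤ) - 3) = (idealPow f ((n : ℤ) - 3)).restrictScalars ℤ := by
  unfold idealPow
  rcases hn.eq_or_lt with rfl | h3
  · rw [if_neg (by norm_num)]
    have h1 : (-(((2 : ℕ) : ℤ) - 3)).toNat = 1 := by norm_num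
    rw [h1, pow_one]
    apply le_antisymm
    · refine Submodule.span_le.2 ?_
      rintro _ ⟨j, rfl⟩
      have hj : natBasis f (((2 : ℕ) : ℤ) - 3) j = zeta f j + (cf f j : L f) := by simp [natBasis]
      simp only [SetLike.mem_coe, Submodule.restrictScalars_mem]
      rw [Submodule.mem_div_iff_forall_mul_mem]
      intro y hy
      rw [idealOne, Submodule.mem_span_pair] at hy
      obtain ⟨a, b, rfl⟩ := hy
      rw [mem_one_iff, hj]
      have : (zeta f j + (cf f j : L f)) * (a • 1 + b • theta f) =
          (a : L f) * (zeta f j + (cf f j : L f)) + (b : L f) * zeta f (j + 1) := by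
        rw [zeta_succ, Algebra.smul_def, Algebra.smul_def]
        change _ * ((a : L f) * 1 + (b : L f) * theta f) = _
        ring
      rw [this]
      exact add_mem (ringSpan_mul_mem f _ _ a.2 (add_mem (zeta_mem_ringSpan f (by omega))
        (intCast_mem_ringSpan f _))) (ringSpan_mul_mem f _ _ b.2 (zeta_mem_ringSpan f (by omega)))
    · intro z hz
      rw [Submodule.restrictScalars_mem, Submodule.mem_div_iff_forall_mul_mem] at hz
      refine mem_natSpan_of_phi_int f hf0 hn (fun w hw => ?_) ?_
      · refine phi_mem_int_of_mem_ringSpan f hf0 hn (ringSpan_mul_mem f _ _ ?_ hw)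
        rw [← mul_one z, ← mem_one_iff]
        exact hz 1 (Submodule.subset_span (by simp))
      · refine phi_mem_int_of_mem_ringSpan f hf0 hn ?_
        rw [← mem_one_iff, mul_comm]
        exact hz _ (Submodule.subset_span (by simp))
  · rw [if_pos (by omega)]
    have := natSpan_eq_pow f (k := ((n : ℤ) - 3).toNat) (by omega)
    rw [← this, Int.toNat_of_nonneg (by omega)]

/-! ### Determinants of Gram matrices -/

/-- Every pair is an inversion of the order-reversing permutation. This is the source of the sign in
the invariant form. -/
theorem sign_revPerm (n : ℕ) :
    ((Equiv.Perm.sign (Fin.revPerm : Equiv.Perm (Fin n)) : ℤˣ) : ℤ) = (-1) ^ (n * (n - 1) / 2) := by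
  rw [Equiv.Perm.sign_eq_prod_prod_Iio]
  have h : ∀ j : Fin n, ∏ i ∈ Finset.Iio j,
      (if (Fin.revPerm i : Fin n) < Fin.revPerm j then (1 : ℤˣ) else -1) = (-1) ^ (j : ℕ) := by
    intro j
    rw [Finset.prod_congr rfl (g := fun _ => (-1 : ℤˣ)), Finset.prod_const, Fin.card_Iio]
    intro i hi
    have hi := Finset.mem_Iio.1 hi
    rw [if_neg]
    simp only [Fin.revPerm_apply, Fin.rev_lt_rev]
    exact hi.not_gt
  rw [Finset.prod_congr rfl fun j _ => h j, Finset.prod_pow_eq_pow_sum,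
    Fin.sum_univ_eq_sum_range (fun i => i) n, Finset.sum_range_id]
  push_cast
  rfl

/-- The matrix φ(θ^{i+j}) vanishes for i + j < n - 1 and equals 1/f₀ on the antidiagonal, so
reversing its columns makes it triangular. -/
theorem det_phi_theta (f : Form n) (hf0 : f 0 ≠ 0) :
    (Matrix.of fun i j : Fin n => phi f hf0 (theta f ^ (i : ℕ) * theta f ^ (j : ℕ))).det =
      (-1) ^ (n * (n - 1) / 2) * ((f 0 : ℚ) ^ n)⁻¹ := by
  set H := Matrix.of fun i j : Fin n => phi f hf0 (theta f ^ (i : ℕ) * theta f ^ (j : ℕ)) with hH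
  have h1 : (H.submatrix id Fin.revPerm).det = ((f 0 : ℚ) ^ n)⁻¹ := by
    rw [Matrix.det_of_isLowerTriangular]
    · rw [Finset.prod_congr rfl (g := fun _ => (f 0 : ℚ)⁻¹), Finset.prod_const, Finset.card_univ,
        Fintype.card_fin, inv_pow]
      intro i _
      simp only [hH, Matrix.submatrix_apply, Matrix.of_apply, id, Fin.revPerm_apply, Fin.val_rev]
      rw [← pow_add, phi_theta_pow f hf0 (by omega), if_pos (by omega)]
    · intro i j hij
      have hij : i < j := hij
      simp only [hH, Matrix.submatrix_apply, Matrix.of_apply, id, Fin.revPerm_apply, Fin.val_rev]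
      rw [← pow_add, phi_theta_pow f hf0 (by omega), if_neg (by omega)]
  rw [Matrix.det_permute'] at h1
  have h2 : (((Equiv.Perm.sign (Fin.revPerm : Equiv.Perm (Fin n)) : ℤˣ) : ℤ) : ℚ) =
      (-1) ^ (n * (n - 1) / 2) := by
    rw [sign_revPerm]; push_cast; rfl
  rw [h2] at h1
  rw [← h1, ← mul_assoc, ← mul_pow]
  simp

/-- Pairing the families c·b_i and b_j gives two changes of basis around the matrix φ(θ^{i+j}); the
factor c contributes the determinant of multiplication by c. -/
theorem det_phi_mul (f : Form n) (hf0 : f 0 ≠ 0) (c : L f) (b : Fin n → L f) :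
    (Matrix.of fun i j : Fin n => phi f hf0 (c * (b i * b j))).det =
      Algebra.norm ℚ c * (thetaBasis f hf0).det b ^ 2 *
        ((-1) ^ (n * (n - 1) / 2) * ((f 0 : ℚ) ^ n)⁻¹) := by
  set e := thetaBasis f hf0 with he
  have hgen : ∀ v w : Fin n → L f, (Matrix.of fun i j : Fin n => phi f hf0 (v i * w j)) =
      (e.toMatrix v).transpose * (Matrix.of fun i j : Fin n =>
        phi f hf0 (theta f ^ (i : ℕ) * theta f ^ (j : ℕ))) * e.toMatrix w := by
    intro v w
    ext i j
    rw [Matrix.of_apply, ← e.sum_toMatrix_smul_self v i, ← e.sum_toMatrix_smul_self w j]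
    simp only [Matrix.mul_apply, Matrix.transpose_apply, Matrix.of_apply, Finset.sum_mul,
      Finset.mul_sum, map_sum, smul_mul_smul_comm, map_smul, smul_eq_mul, he, thetaBasis_apply]
    refine Finset.sum_congr rfl fun k _ => Finset.sum_congr rfl fun l _ => ?_
    ring
  have h := hgen (fun i => c * b i) b
  simp only [mul_assoc] at h
  rw [h, Matrix.det_mul, Matrix.det_mul, Matrix.det_transpose, ← Module.Basis.det_apply,
    ← Module.Basis.det_apply, det_phi_theta]
  have hc : e.det (fun i => c * b i) = Algebra.norm ℚ c * e.det b := by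
    rw [Algebra.norm_apply, ← Module.Basis.det_comp]
    rfl
  rw [hc]
  ring

/-! ### The norm form -/

theorem sum_cf_eq_eval (f : Form n) {s t : ℚ} (ht : t ≠ 0) :
    ∑ i ∈ Finset.range (n + 1), (cf f i : ℚ) * s ^ (n - i) * t ^ i =
      t ^ n * ((dehom f).map (Int.castRingHom ℚ)).eval (s / t) := by
  unfold dehom
  rw [Polynomial.map_sum, Polynomial.eval_finsetSum, Finset.mul_sum]
  refine Finset.sum_congr rfl fun i hi => ?_
  have hi := Finset.mem_range.1 hi
  have : t ^ n = t ^ (n - i) * t ^ i := by rw [← pow_add]; congr 1; omega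
  simp only [Polynomial.map_mul, Polynomial.map_pow, Polynomial.map_C, Polynomial.map_X,
    Polynomial.eval_mul, Polynomial.eval_C, Polynomial.eval_pow, Polynomial.eval_X]
  rw [this, div_pow]
  field_simp
  simp [mul_comm]

/-- N(s - θ) is the characteristic polynomial of multiplication by θ at s, and that polynomial is
the monic multiple g of f(x,1). -/
theorem norm_algebraMap_sub_theta (f : Form n) (hf0 : f 0 ≠ 0) (s : ℚ) :
    (f 0 : ℚ) * Algebra.norm ℚ (algebraMap ℚ (L f) s - theta f) =
      ((dehom f).map (Int.castRingHom ℚ)).eval s := by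
  have hf : (f 0 : ℚ) ≠ 0 := by exact_mod_cast hf0
  let pb := AdjoinRoot.powerBasis (dehom_map_ne_zero hf0)
  have h1 := charpoly_leftMulMatrix pb
  rw [AdjoinRoot.minpoly_powerBasis_gen, leadingCoeff_dehom_map hf0] at h1
  have h2 := congrArg (Polynomial.eval s) h1
  rw [Matrix.eval_charpoly, Polynomial.eval_mul, Polynomial.eval_C] at h2
  have h3 : Matrix.scalar _ s - Algebra.leftMulMatrix pb.basis pb.gen =
      Algebra.leftMulMatrix pb.basis (algebraMap ℚ (L f) s - theta f) := by
    rw [map_sub, AlgHom.commutes]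
    rfl
  rw [h3, ← Algebra.norm_eq_matrix_det] at h2
  rw [h2]
  field_simp

theorem norm_sub_theta (f : Form n) (hf0 : f 0 ≠ 0) (s t : ℚ) :
    (f 0 : ℚ) * Algebra.norm ℚ (algebraMap ℚ (L f) s - algebraMap ℚ (L f) t * theta f) =
      ∑ i ∈ Finset.range (n + 1), (cf f i : ℚ) * s ^ (n - i) * t ^ i := by
  rcases eq_or_ne t 0 with rfl | ht
  · rw [map_zero, zero_mul, sub_zero, Algebra.norm_algebraMap, finrank_L hf0,
      Finset.sum_eq_single 0]
    · simp [cf_zero]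
    · intro i _ hi
      simp [hi]
    · simp
  · have : algebraMap ℚ (L f) s - algebraMap ℚ (L f) t * theta f =
        algebraMap ℚ (L f) t * (algebraMap ℚ (L f) (s / t) - theta f) := by
      rw [mul_sub, ← map_mul, mul_div_cancel₀ _ ht]
    rw [this, map_mul, Algebra.norm_algebraMap, finrank_L hf0, mul_left_comm,
      norm_algebraMap_sub_theta f hf0, sum_cf_eq_eval f ht]

/-! ### The invariant form of a Gram pair -/

/-- `A_ij = φ(b_i b_j / α)` and `B_ij = φ(θ b_i b_j / α)`. -/
def IsPhiGram (f : Form n) (hf0 : f 0 ≠ 0) (α : (L f)ˣ) (b : Fin n → L f) (v : SymPair n) : Prop :=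
  ∀ i j, (v.A i j : ℚ) = phi f hf0 (((α⁻¹ : (L f)ˣ) : L f) * (b i * b j)) ∧
    (v.B i j : ℚ) = phi f hf0 (theta f * (((α⁻¹ : (L f)ˣ) : L f) * (b i * b j)))

theorem eval_invariant (v : SymPair n) (x : Fin 2 → ℤ) :
    MvPolynomial.eval x v.invariant =
      (-1) ^ (n * (n - 1) / 2) * (x 0 • v.A - x 1 • v.B).det := by
  unfold SymPair.invariant
  rw [map_mul, map_pow, map_neg, map_one, RingHom.map_det]
  congr 2
  ext i j
  simp [Matrix.sub_apply, Matrix.smul_apply, -zsmul_eq_mul]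

theorem eval_toPoly (f : Form n) (x : Fin 2 → ℤ) :
    MvPolynomial.eval x (toPoly f) =
      ∑ i ∈ Finset.range (n + 1), cf f i * x 0 ^ (n - i) * x 1 ^ i := by
  unfold toPoly
  rw [map_sum]
  refine Finset.sum_congr rfl fun i _ => ?_
  simp

/-- `det_phi_mul` with c = (s - tθ)/α, denominators cleared. -/
theorem det_isPhiGram {f : Form n} {hf0 : f 0 ≠ 0} {α : (L f)ˣ} {b : Fin n → L f} {v : SymPair n}
    (h : IsPhiGram f hf0 α b v) (s t : ℤ) :
    (f 0 : ℚ) ^ (n + 1) * Algebra.norm ℚ (α : L f) *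
      ((-1) ^ (n * (n - 1) / 2) * ((s • v.A - t • v.B).det : ℚ)) =
      (∑ i ∈ Finset.range (n + 1), (cf f i : ℚ) * (s : ℚ) ^ (n - i) * (t : ℚ) ^ i) *
        (thetaBasis f hf0).det b ^ 2 := by
  have hf : (f 0 : ℚ) ≠ 0 := by exact_mod_cast hf0
  have hα : Algebra.norm ℚ (α : L f) * Algebra.norm ℚ ((α⁻¹ : (L f)ˣ) : L f) = 1 := by
    rw [← map_mul, Units.mul_inv, map_one]
  have hdet := det_phi_mul f hf0
    ((algebraMap ℚ (L f) s - algebraMap ℚ (L f) t * theta f) * ((α⁻¹ : (L f)ˣ) : L f)) b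
  have hmat : (Matrix.of fun i j : Fin n => phi f hf0
      ((algebraMap ℚ (L f) s - algebraMap ℚ (L f) t * theta f) * ((α⁻¹ : (L f)ˣ) : L f) *
        (b i * b j))) = (s • v.A - t • v.B).map (Int.castRingHom ℚ) := by
    ext i j
    have : (algebraMap ℚ (L f) s - algebraMap ℚ (L f) t * theta f) * ((α⁻¹ : (L f)ˣ) : L f) *
        (b i * b j) = (s : ℚ) • (((α⁻¹ : (L f)ˣ) : L f) * (b i * b j)) -
          (t : ℚ) • (theta f * (((α⁻¹ : (L f)ˣ) : L f) * (b i * b j))) := by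
      rw [Algebra.smul_def, Algebra.smul_def]; ring
    rw [Matrix.of_apply, this, map_sub, map_smul, map_smul, ← (h i j).1, ← (h i j).2]
    simp [Matrix.sub_apply, Matrix.smul_apply, -zsmul_eq_mul]
  rw [hmat, ← RingHom.mapMatrix_apply, ← RingHom.map_det, map_mul] at hdet
  simp only [eq_intCast] at hdet
  rw [hdet, ← norm_sub_theta f hf0]
  have hsign : ((-1 : ℚ) ^ (n * (n - 1) / 2)) * (-1) ^ (n * (n - 1) / 2) = 1 := by
    rw [← mul_pow]; simp
  calc _ = (Algebra.norm ℚ (α : L f) * Algebra.norm ℚ ((α⁻¹ : (L f)ˣ) : L f)) *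
        (((-1 : ℚ) ^ (n * (n - 1) / 2)) * (-1) ^ (n * (n - 1) / 2)) *
        ((f 0 : ℚ) ^ n * ((f 0 : ℚ) ^ n)⁻¹) *
        ((f 0 : ℚ) * Algebra.norm ℚ (algebraMap ℚ (L f) s - algebraMap ℚ (L f) t * theta f) *
          (thetaBasis f hf0).det b ^ 2) := by ring
    _ = _ := by
      rw [hα, hsign, mul_inv_cancel₀ (pow_ne_zero _ hf)]
      ring

/-- The invariant form is always a constant multiple of f, and the norm condition says that the
constant is 1. So evaluation at (1, 0) suffices in one direction; the other compares values at all
integer points. -/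
theorem invariant_iff {f : Form n} {hf0 : f 0 ≠ 0} (hn : 2 ≤ n) {α : (L f)ˣ}
    {b : Module.Basis (Fin n) ℚ (L f)} {v : SymPair n} (h : IsPhiGram f hf0 α b v) :
    v.invariant = toPoly f ↔
      (natBasisQ f hf0 0).det b ^ 2 =
        Algebra.norm ℚ (α : L f) / (f 0 : ℚ) ^ ((n : ℤ) - 3) := by
  have hf : (f 0 : ℚ) ≠ 0 := by exact_mod_cast hf0
  have hα : Algebra.norm ℚ (α : L f) ≠ 0 := (α.isUnit.map (Algebra.norm ℚ)).ne_zero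
  -- The square of the determinant f₀ⁿ⁻¹ of R_f over ℤ[θ]-coordinates, split off from the f₀ⁿ⁺¹ of
  -- `det_isPhiGram`: this is where the exponent n - 3 arises.
  have hpow : (f 0 : ℚ) ^ (2 * (n - 1)) = (f 0 : ℚ) ^ (n + 1) * (f 0 : ℚ) ^ ((n : ℤ) - 3) := by
    rw [← zpow_natCast, ← zpow_natCast, ← zpow_add₀ hf]
    congr 1
    push_cast [Nat.cast_sub (by omega : 1 ≤ n)]
    ring
  have hD : (thetaBasis f hf0).det b ^ 2 = (f 0 : ℚ) ^ (n + 1) * ((f 0 : ℚ) ^ ((n : ℤ) - 3) *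
      (natBasisQ f hf0 0).det b ^ 2) := by
    rw [det_thetaBasis_eq, mul_pow, ← pow_mul, mul_comm (n - 1) 2, hpow, mul_assoc]
  have hz : (f 0 : ℚ) ^ ((n : ℤ) - 3) ≠ 0 := zpow_ne_zero _ hf
  have hp : (f 0 : ℚ) ^ (n + 1) ≠ 0 := pow_ne_zero _ hf
  rw [eq_div_iff hz, mul_comm ((natBasisQ f hf0 0).det b ^ 2)]
  rw [MvPolynomial.funext_iff]
  constructor
  · intro hv
    have h1 := hv ![1, 0]
    rw [eval_invariant, eval_toPoly] at h1
    have h2 := det_isPhiGram h 1 0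
    have h3 := congrArg (fun m : ℤ => (m : ℚ)) h1
    simp only [Matrix.cons_val_zero, Matrix.cons_val_one] at h3
    push_cast at h3 h2
    rw [h3, hD] at h2
    have hs : ∑ i ∈ Finset.range (n + 1), (cf f i : ℚ) * 1 ^ (n - i) * 0 ^ i = (f 0 : ℚ) := by
      rw [Finset.sum_eq_single 0]
      · simp [cf_zero]
      · intro i _ hi
        simp [hi]
      · simp
    rw [hs, mul_comm (f 0 : ℚ), mul_assoc, mul_assoc, mul_assoc] at h2
    have h4 := mul_left_cancel₀ hp h2
    rw [mul_comm, mul_comm _ (f 0 : ℚ), ← mul_assoc] at h4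
    have h5 : (f 0 : ℚ) * Algebra.norm ℚ (α : L f) = (f 0 : ℚ) *
      ((f 0 : ℚ) ^ ((n : ℤ) - 3) * (natBasisQ f hf0 0).det b ^ 2) := by linarith
    exact (mul_left_cancel₀ hf h5).symm
  · intro hd x
    rw [eval_invariant, eval_toPoly]
    have h2 := det_isPhiGram h (x 0) (x 1)
    rw [hD, hd, mul_comm (∑ i ∈ _, _)] at h2
    have h3 := mul_left_cancel₀ (mul_ne_zero hp hα) h2
    exact_mod_cast h3

/-! ### Lattices in `L` and their bases -/

theorem exists_basis_of_span {f : Form n} {I : Submodule (order f) (L f)}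
    (w : Module.Basis (Fin n) ℚ (L f)) (h : I.restrictScalars ℤ = Submodule.span ℤ (Set.range w)) :
    ∃ b : Module.Basis (Fin n) ℤ I, ∀ i, (b i : L f) = w i := by
  have hmem : ∀ i, w i ∈ I := fun i => by
    have : w i ∈ I.restrictScalars ℤ := h ▸ Submodule.subset_span ⟨i, rfl⟩
    exact this
  have hli : LinearIndependent ℤ fun i => (⟨w i, hmem i⟩ : I) := by
    have h1 : LinearIndependent ℤ w := (LinearIndependent.iff_fractionRing ℤ ℚ).2 w.linearIndependent
    exact LinearIndependent.of_comp (I.subtype.restrictScalars ℤ) h1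
  refine ⟨Module.Basis.mk hli ?_, fun i => by rw [Module.Basis.mk_apply]⟩
  rintro ⟨x, hx⟩ -
  have hx' : x ∈ Submodule.span ℤ (Set.range w) := h ▸ hx
  obtain ⟨c, hc⟩ := (Submodule.mem_span_range_iff_exists_fun ℤ).1 hx'
  rw [Submodule.mem_span_range_iff_exists_fun]
  refine ⟨c, Subtype.ext (Eq.trans ?_ hc)⟩
  simp

theorem exists_basisQ {f : Form n} (hf0 : f 0 ≠ 0) {I : Submodule (order f) (L f)}
    (b : Module.Basis (Fin n) ℤ I) :
    ∃ w : Module.Basis (Fin n) ℚ (L f), (∀ i, w i = (b i : L f)) ∧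
      I.restrictScalars ℤ = Submodule.span ℤ (Set.range w) := by
  rcases Nat.eq_zero_or_pos n with rfl | hn
  · have : Subsingleton (L f) := by
      have := finiteDimensional_L hf0
      exact Module.finrank_zero_iff.1 (finrank_L hf0)
    exact ⟨Module.Basis.empty (L f), fun i => i.elim0, Subsingleton.elim _ _⟩
  have : Nonempty (Fin n) := ⟨⟨0, hn⟩⟩
  have hli : LinearIndependent ℚ fun i => (b i : L f) :=
    (LinearIndependent.iff_fractionRing ℤ ℚ).1
      (b.linearIndependent.map' (I.subtype.restrictScalars ℤ)
        (LinearMap.ker_eq_bot.2 Subtype.val_injective))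
  have hcoe := coe_basisOfLinearIndependentOfCardEqFinrank hli
    (by rw [finrank_L hf0, Fintype.card_fin])
  refine ⟨basisOfLinearIndependentOfCardEqFinrank hli (by rw [finrank_L hf0, Fintype.card_fin]),
    fun i => by rw [hcoe], ?_⟩
  rw [hcoe]
  apply le_antisymm
  · intro x hx
    rw [Submodule.mem_span_range_iff_exists_fun]
    refine ⟨b.repr ⟨x, hx⟩, ?_⟩
    refine Eq.trans ?_ (congrArg Subtype.val (b.sum_repr ⟨x, hx⟩))
    simp [-Module.Basis.sum_repr]
  · refine Submodule.span_le.2 ?_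
    rintro _ ⟨i, rfl⟩
    exact (b i).2

/-- The family `(∑ⱼ gᵢⱼ bⱼ)ᵢ`. -/
noncomputable def act {f : Form n} (g : Matrix (Fin n) (Fin n) ℤ) (b : Fin n → L f) : Fin n → L f :=
  fun i => ∑ j, g i j • b j

theorem act_mul {f : Form n} (g h : Matrix (Fin n) (Fin n) ℤ) (b : Fin n → L f) :
    act (g * h) b = act g (act h b) := by
  ext i
  simp only [act, Matrix.mul_apply, Finset.sum_smul, Finset.smul_sum, smul_smul]
  rw [Finset.sum_comm]

theorem act_one {f : Form n} (b : Fin n → L f) : act 1 b = b := by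
  ext i
  simp [act, Matrix.one_apply, ite_smul]

theorem act_injective {f : Form n} (b : Module.Basis (Fin n) ℚ (L f))
    {g h : Matrix (Fin n) (Fin n) ℤ} (hgh : act g b = act h b) : g = h := by
  ext i j
  have hli : LinearIndependent ℤ b := (LinearIndependent.iff_fractionRing ℤ ℚ).2 b.linearIndependent
  have := Fintype.linearIndependent_iff.1 hli (fun j => g i j - h i j) (by
    have := congrFun hgh i
    simp only [act] at this
    simp only [sub_smul, Finset.sum_sub_distrib, this, sub_self]) j
  linarith

theorem act_mul_left {f : Form n} (g : Matrix (Fin n) (Fin n) ℤ) (b : Fin n → L f) (c : L f) :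
    act g (fun i => c * b i) = fun i => c * act g b i := by
  ext i
  simp [act, Finset.mul_sum, mul_left_comm]

theorem det_act {f : Form n} (e : Module.Basis (Fin n) ℚ (L f)) (g : Matrix (Fin n) (Fin n) ℤ)
    (b : Fin n → L f) : e.det (act g b) = (g.det : ℚ) * e.det b := by
  have : e.toMatrix (act g b) = e.toMatrix b * (g.map (Int.castRingHom ℚ)).transpose := by
    ext i j
    simp only [Module.Basis.toMatrix_apply, act, Matrix.mul_apply, Matrix.transpose_apply, map_sum,
      Finsupp.finsetSum_apply, map_zsmul, Finsupp.smul_apply, Matrix.map_apply]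
    simp only [zsmul_eq_mul]
    exact Finset.sum_congr rfl fun k _ => mul_comm _ _
  rw [Module.Basis.det_apply, this, Matrix.det_mul, Matrix.det_transpose, ← RingHom.mapMatrix_apply,
    ← RingHom.map_det, mul_comm]
  rfl

theorem det_mul_left {f : Form n} (e : Module.Basis (Fin n) ℚ (L f)) (c : L f) (b : Fin n → L f) :
    e.det (fun i => c * b i) = Algebra.norm ℚ c * e.det b := by
  rw [Algebra.norm_apply, ← Module.Basis.det_comp]
  rfl

theorem exists_basis_of_det_ne_zero {f : Form n} (e : Module.Basis (Fin n) ℚ (L f))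
    {v : Fin n → L f} (h : e.det v ≠ 0) : ∃ w : Module.Basis (Fin n) ℚ (L f), ⇑w = v := by
  have := e.is_basis_iff_det.2 (isUnit_iff_ne_zero.2 h)
  exact ⟨Module.Basis.mk this.1 this.2.ge, Module.Basis.coe_mk _ _⟩

theorem exists_act_basis {f : Form n} (w : Module.Basis (Fin n) ℚ (L f))
    {g : Matrix (Fin n) (Fin n) ℤ} (hg : g.det ≠ 0) :
    ∃ w' : Module.Basis (Fin n) ℚ (L f), ⇑w' = act g w := by
  refine exists_basis_of_det_ne_zero w ?_
  rw [det_act, Module.Basis.det_self, mul_one]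
  exact_mod_cast hg

theorem exists_mul_basis {f : Form n} (w : Module.Basis (Fin n) ℚ (L f)) (κ : (L f)ˣ) :
    ∃ w' : Module.Basis (Fin n) ℚ (L f), ⇑w' = fun i => (κ : L f) * w i := by
  refine exists_basis_of_det_ne_zero w ?_
  rw [det_mul_left, Module.Basis.det_self, mul_one]
  exact (κ.isUnit.map (Algebra.norm ℚ)).ne_zero

theorem span_act_le {f : Form n} (g : Matrix (Fin n) (Fin n) ℤ) (b : Fin n → L f) :
    Submodule.span ℤ (Set.range (act g b)) ≤ Submodule.span ℤ (Set.range b) := by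
  refine Submodule.span_le.2 ?_
  rintro _ ⟨i, rfl⟩
  exact Submodule.sum_mem _ fun j _ => Submodule.smul_mem _ _ (Submodule.subset_span ⟨j, rfl⟩)

theorem span_act {f : Form n} (g : Matrix.SpecialLinearGroup (Fin n) ℤ) (b : Fin n → L f) :
    Submodule.span ℤ (Set.range (act g.1 b)) = Submodule.span ℤ (Set.range b) := by
  refine le_antisymm (span_act_le _ _) ?_
  have h : act (g⁻¹).1 (act g.1 b) = b := by
    rw [← act_mul, ← Matrix.SpecialLinearGroup.coe_mul, inv_mul_cancel,
      Matrix.SpecialLinearGroup.coe_one, act_one]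
  conv_lhs => rw [← h]
  exact span_act_le _ _

theorem exists_act_of_mem_span {f : Form n} {b v : Fin n → L f}
    (h : ∀ i, v i ∈ Submodule.span ℤ (Set.range b)) : ∃ g, v = act g b := by
  choose c hc using fun i => (Submodule.mem_span_range_iff_exists_fun ℤ).1 (h i)
  exact ⟨Matrix.of c, funext fun i => (hc i).symm⟩

/-- The transition matrix is invertible over ℤ, so its determinant is ±1, and equal orientations
exclude -1. -/
theorem exists_specialLinear_act {f : Form n} {ε : ℤˣ} (e w w' : Module.Basis (Fin n) ℚ (L f))
    (h : Submodule.span ℤ (Set.range w) = Submodule.span ℤ (Set.range w'))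
    (hw : 0 < ((ε : ℤ) : ℚ) * e.det w) (hw' : 0 < ((ε : ℤ) : ℚ) * e.det w') :
    ∃ g : Matrix.SpecialLinearGroup (Fin n) ℤ, ⇑w' = act g.1 w := by
  obtain ⟨g, hg⟩ := exists_act_of_mem_span (b := w) (v := w')
    fun i => h ▸ Submodule.subset_span ⟨i, rfl⟩
  obtain ⟨g', hg'⟩ := exists_act_of_mem_span (b := w') (v := w)
    fun i => h ▸ Submodule.subset_span ⟨i, rfl⟩
  have hmul : g' * g = 1 := act_injective w (by rw [act_mul, ← hg, ← hg', act_one])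
  have hunit : IsUnit g.det := by
    refine IsUnit.of_mul_eq_one_right g'.det ?_
    rw [← Matrix.det_mul, hmul, Matrix.det_one]
  refine ⟨⟨g, ?_⟩, hg⟩
  rcases Int.isUnit_iff.1 hunit with h1 | h1
  · exact h1
  · rw [hg, det_act, h1] at hw'
    push_cast at hw'
    linarith

/-! ### Gram data -/

theorem isPhiGram_act {f : Form n} {hf0 : f 0 ≠ 0} {α : (L f)ˣ} {b : Fin n → L f} {v : SymPair n}
    (h : IsPhiGram f hf0 α b v) (g : Matrix.SpecialLinearGroup (Fin n) ℤ) :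
    IsPhiGram f hf0 α (act g.1 b) (g • v) := by
  have key : ∀ (l : L f →ₗ[ℚ] ℚ) (M : Matrix (Fin n) (Fin n) ℤ)
      (_ : ∀ i j, (M i j : ℚ) = l (b i * b j)) (i j : Fin n),
      ((g.1 * M * g.1.transpose) i j : ℚ) = l (act g.1 b i * act g.1 b j) := by
    intro l M hM i j
    simp only [Matrix.mul_apply, Matrix.transpose_apply, act, Finset.sum_mul, Finset.mul_sum,
      map_sum, smul_mul_smul_comm, map_zsmul, ← hM]
    push_cast
    refine Finset.sum_congr rfl fun k _ => Finset.sum_congr rfl fun l _ => ?_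
    simp only [zsmul_eq_mul]
    push_cast
    ring
  intro i j
  exact ⟨key (phi f hf0 ∘ₗ LinearMap.mulLeft ℚ ((α⁻¹ : (L f)ˣ) : L f)) v.A
      (fun i j => (h i j).1) i j,
    key (phi f hf0 ∘ₗ LinearMap.mulLeft ℚ (theta f) ∘ₗ LinearMap.mulLeft ℚ ((α⁻¹ : (L f)ˣ) : L f))
      v.B (fun i j => (h i j).2) i j⟩

theorem isPhiGram_unique {f : Form n} {hf0 : f 0 ≠ 0} {α : (L f)ˣ} {b : Fin n → L f}
    {v v' : SymPair n} (h : IsPhiGram f hf0 α b v) (h' : IsPhiGram f hf0 α b v') : v = v' := by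
  apply SymPair.ext
  · ext i j
    have := (h i j).1.trans (h' i j).1.symm
    exact_mod_cast this
  · ext i j
    have := (h i j).2.trans (h' i j).2.symm
    exact_mod_cast this

theorem isPhiGram_mul {f : Form n} {hf0 : f 0 ≠ 0} {α : (L f)ˣ} {b : Fin n → L f} {v : SymPair n}
    (h : IsPhiGram f hf0 α b v) (κ : (L f)ˣ) :
    IsPhiGram f hf0 (κ ^ 2 * α) (fun i => (κ : L f) * b i) v := by
  have hk : ∀ i j, (((κ ^ 2 * α)⁻¹ : (L f)ˣ) : L f) * (((κ : L f) * b i) * ((κ : L f) * b j)) =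
      ((α⁻¹ : (L f)ˣ) : L f) * (b i * b j) := by
    intro i j
    have h1 : (((κ ^ 2 * α)⁻¹ : (L f)ˣ) : L f) * (κ : L f) ^ 2 = ((α⁻¹ : (L f)ˣ) : L f) := by
      rw [← Units.val_pow_eq_pow_val, ← Units.val_mul]
      congr 1
      rw [mul_inv_rev, inv_mul_cancel_right]
    rw [← h1]
    ring
  intro i j
  rw [hk]
  exact h i j

/-- The linear map σ taking b to b' is an isometry for the A-forms and for the B-forms. The B-form
is the A-form with θ inserted, so nondegeneracy makes σ commute with θ; it is then multiplication by
κ = σ(1), a unit because σ is onto. -/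
theorem exists_unit_of_isPhiGram {f : Form n} {hf0 : f 0 ≠ 0} {α α' : (L f)ˣ}
    {b b' : Module.Basis (Fin n) ℚ (L f)} {v : SymPair n}
    (h : IsPhiGram f hf0 α b v) (h' : IsPhiGram f hf0 α' b' v) :
    ∃ κ : (L f)ˣ, (∀ i, b' i = (κ : L f) * b i) ∧ α' = κ ^ 2 * α := by
  let σ : L f ≃ₗ[ℚ] L f := b.equiv b' (Equiv.refl _)
  have hσb : ∀ i, σ (b i) = b' i := fun i => by simp [σ]
  have hform : ∀ c c' : L f, (∀ i j, phi f hf0 (c' * (b' i * b' j)) = phi f hf0 (c * (b i * b j))) →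
      ∀ x y, phi f hf0 (c' * (σ x * σ y)) = phi f hf0 (c * (x * y)) := by
    intro c c' hcc x y
    let B1 : L f →ₗ[ℚ] L f →ₗ[ℚ] ℚ :=
      ((LinearMap.mul ℚ (L f)).compr₂ (phi f hf0 ∘ₗ LinearMap.mulLeft ℚ c')).compl₁₂
        (σ : L f →ₗ[ℚ] L f) (σ : L f →ₗ[ℚ] L f)
    let B2 : L f →ₗ[ℚ] L f →ₗ[ℚ] ℚ :=
      (LinearMap.mul ℚ (L f)).compr₂ (phi f hf0 ∘ₗ LinearMap.mulLeft ℚ c)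
    have hB : B1 = B2 := LinearMap.ext_basis b b fun i j => by
      simpa [B1, B2, hσb] using hcc i j
    exact LinearMap.congr_fun₂ hB x y
  have hA := hform _ _ fun i j => (h' i j).1.symm.trans (h i j).1
  have hB := hform (theta f * ((α⁻¹ : (L f)ˣ) : L f)) (theta f * ((α'⁻¹ : (L f)ˣ) : L f))
    fun i j => by
      rw [mul_assoc, mul_assoc]
      exact (h' i j).2.symm.trans (h i j).2
  have hcomm : ∀ x, σ (theta f * x) = theta f * σ x := by
    intro x
    rw [← sub_eq_zero, ← Units.mul_right_eq_zero α'⁻¹]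
    refine eq_zero_of_phi_mul_eq_zero f hf0 fun w => ?_
    obtain ⟨y, rfl⟩ := σ.surjective w
    have h1 := hA (theta f * x) y
    have h2 := hB x y
    have e1 : ((α'⁻¹ : (L f)ˣ) : L f) * (σ (theta f * x) - theta f * σ x) * σ y =
        ((α'⁻¹ : (L f)ˣ) : L f) * (σ (theta f * x) * σ y) -
          theta f * ((α'⁻¹ : (L f)ˣ) : L f) * (σ x * σ y) := by ring
    rw [e1, map_sub, h1, h2, sub_eq_zero]
    congr 1
    ring
  have hmul := linearMap_eq_mul_one (σ : L f →ₗ[ℚ] L f) hcomm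
  obtain ⟨x, hx⟩ := σ.surjective 1
  have hunit : IsUnit (σ 1) := by
    refine IsUnit.of_mul_eq_one_right x ?_
    have := hmul x
    simp only [LinearEquiv.coe_coe] at this
    rw [← this, hx]
  obtain ⟨κ, hκ⟩ := hunit
  refine ⟨κ, fun i => ?_, ?_⟩
  · rw [← hσb, hκ, mul_comm]
    exact hmul _
  -- The isometry property at (1, w) says φ(κ²w/α') = φ(w/α) for all w.
  · have hinv : ((α'⁻¹ : (L f)ˣ) : L f) * (κ : L f) ^ 2 = ((α⁻¹ : (L f)ˣ) : L f) := by
      rw [← sub_eq_zero]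
      refine eq_zero_of_phi_mul_eq_zero f hf0 fun w => ?_
      have h1 := hA 1 w
      have h2 := hmul w
      simp only [LinearEquiv.coe_coe] at h2
      rw [h2, ← hκ, one_mul] at h1
      rw [sub_mul, map_sub, ← h1, sub_eq_zero]
      congr 1
      ring
    have hinv' : α'⁻¹ * κ ^ 2 = α⁻¹ := Units.ext (by push_cast; exact hinv)
    rw [inv_mul_eq_iff_eq_mul] at hinv'
    rw [hinv', mul_assoc, inv_mul_cancel, mul_one]

/-- The injection u ↦ (1 + u)/2 lands in the idempotents, which correspond to clopen subsets of the
finite spectrum of the Artinian ring L. -/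
theorem finite_sq_eq_one {f : Form n} (hf0 : f 0 ≠ 0) : Finite {u : L f // u ^ 2 = 1} := by
  have := finiteDimensional_L hf0
  have : IsArtinianRing (L f) := IsArtinianRing.of_finite ℚ (L f)
  have hfin : Finite {e : L f // IsIdempotentElem e} :=
    Finite.of_injective PrimeSpectrum.isIdempotentElemEquivClopens.toFun
      PrimeSpectrum.isIdempotentElemEquivClopens.injective
  have h2 : algebraMap ℚ (L f) 2⁻¹ * 2 = 1 := by
    rw [← map_ofNat (algebraMap ℚ (L f)) 2, ← map_mul]
    norm_num
  refine Finite.of_injective (β := {e : L f // IsIdempotentElem e})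
    (fun u => ⟨algebraMap ℚ (L f) 2⁻¹ * (1 + u.1), ?_⟩) ?_
  · have := u.2
    unfold IsIdempotentElem
    linear_combination (algebraMap ℚ (L f) 2⁻¹) ^ 2 * this +
      (algebraMap ℚ (L f) 2⁻¹ * (1 + u.1)) * h2
  · intro u v huv
    have := congrArg Subtype.val huv
    simp only at this
    refine Subtype.ext ?_
    linear_combination 2 * this + (v.1 - u.1) * h2

/-! ### Cyclic vectors -/

section Cyclic

open Polynomial

/-- Over an algebraic closure every eigenvalue is a root of the minimal polynomial; as the roots of
the characteristic polynomial are simple there, it divides the minimal polynomial. -/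
theorem minpoly_eq_charpoly_of_separable {K ι : Type*} [Field K] [Fintype ι] [DecidableEq ι]
    (M : Matrix ι ι K) (h : M.charpoly.Separable) : minpoly K M = M.charpoly := by
  have hint : IsIntegral K M := Algebra.IsIntegral.isIntegral M
  refine Polynomial.eq_of_monic_of_associated (minpoly.monic hint) M.charpoly_monic
    (associated_of_dvd_dvd (Matrix.minpoly_dvd_charpoly M) ?_)
  let E := AlgebraicClosure K
  let i := algebraMap K E
  rw [← Polynomial.map_dvd_map' i]
  have hsep : (M.charpoly.map i).Separable := h.map
  refine (IsAlgClosed.splits (M.charpoly.map i)).dvd_of_roots_le_roots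
    (M.charpoly_monic.map i).ne_zero ?_
  rw [Multiset.le_iff_subset (nodup_roots hsep)]
  intro μ hμ
  rw [mem_roots (M.charpoly_monic.map i).ne_zero, ← Matrix.charpoly_map, ← Matrix.charpoly_toLin',
    ← Module.End.hasEigenvalue_iff_isRoot_charpoly, Module.End.hasEigenvalue_iff_isRoot,
    Matrix.minpoly_toLin'] at hμ
  rw [mem_roots ((minpoly.monic hint).map i).ne_zero]
  refine hμ.dvd (minpoly.dvd _ _ ?_)
  have h1 := Polynomial.map_aeval_eq_aeval_map (R := K) (S := Matrix ι ι K) (T := E)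
    (U := Matrix ι ι E) (φ := i) (ψ := i.mapMatrix) (by
      ext a : 1
      change algebraMap E (Matrix ι ι E) (i a) = (algebraMap K (Matrix ι ι K) a).map i
      rw [Matrix.algebraMap_eq_diagonal, Matrix.algebraMap_eq_diagonal,
        Matrix.diagonal_map (map_zero i)]
      rfl) (minpoly K M) M
  rw [minpoly.aeval, map_zero] at h1
  exact h1.symm

/-- For each prime factor p of the minimal polynomial μ, the kernel of (μ/p)(T) is a proper
subspace. Over an infinite field finitely many of these do not cover V, and a vector outside them is
annihilated by no proper divisor of μ. -/
theorem exists_cyclic_vector {K V : Type*} [Field K] [Infinite K] [AddCommGroup V] [Module K V]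
    [FiniteDimensional K V] (T : Module.End K V) :
    ∃ v : V, ∀ q : K[X], aeval T q v = 0 → minpoly K T ∣ q := by
  classical
  have hint : IsIntegral K T := Algebra.IsIntegral.isIntegral T
  set μ := minpoly K T with hμ
  have hμ0 : μ ≠ 0 := minpoly.ne_zero hint
  let s : Finset (Subspace K V) :=
    (UniqueFactorizationMonoid.normalizedFactors μ).toFinset.image
      fun p => LinearMap.ker (aeval T (μ / p))
  have hs : ⊤ ∉ s := by
    intro h
    obtain ⟨p, hp, hker⟩ := Finset.mem_image.1 h
    rw [Multiset.mem_toFinset] at hp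
    have hirr := UniqueFactorizationMonoid.irreducible_of_normalized_factor p hp
    have hdvd := UniqueFactorizationMonoid.dvd_of_mem_normalizedFactors hp
    have hprod : p * (μ / p) = μ := EuclideanDomain.mul_div_cancel' hirr.ne_zero hdvd
    have h0 : μ ∣ μ / p := minpoly.dvd _ _ (LinearMap.ker_eq_top.1 hker)
    obtain ⟨c, hc⟩ := h0
    refine hirr.not_isUnit (IsUnit.of_mul_eq_one c ?_)
    refine mul_left_cancel₀ hμ0 ?_
    calc μ * (p * c) = p * (μ * c) := by ring
      _ = μ * 1 := by rw [← hc, hprod, mul_one]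
  obtain ⟨v, hv⟩ := (Set.ne_univ_iff_exists_notMem _).1 (Subspace.biUnion_ne_univ_of_top_notMem hs)
  refine ⟨v, fun q hq => ?_⟩
  -- By Bézout gcd(q, μ) kills v; if it were a proper divisor of μ, it would divide some μ/p.
  have hd : aeval T (EuclideanDomain.gcd q μ) v = 0 := by
    rw [EuclideanDomain.gcd_eq_gcd_ab, map_add, mul_comm, mul_comm μ, map_mul, map_mul,
      LinearMap.add_apply, Module.End.mul_apply, Module.End.mul_apply, hq, minpoly.aeval]
    simp
  obtain ⟨e, he⟩ := EuclideanDomain.gcd_dvd_right q μ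
  by_cases hunit : IsUnit e
  · have : μ ∣ EuclideanDomain.gcd q μ := by
      conv_lhs => rw [he]
      exact hunit.dvd_mul_right.1 dvd_rfl
    exact this.trans (EuclideanDomain.gcd_dvd_left q μ)
  · exfalso
    have he0 : e ≠ 0 := fun h => hμ0 (by rw [he, h, mul_zero])
    obtain ⟨p, hp, hpe⟩ := WfDvdMonoid.exists_irreducible_factor hunit he0
    obtain ⟨p', hp', hass⟩ := UniqueFactorizationMonoid.exists_mem_normalizedFactors_of_dvd hμ0 hp
      (hpe.trans (Dvd.intro_left _ he.symm))
    have hirr := UniqueFactorizationMonoid.irreducible_of_normalized_factor p' hp'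
    have hdvd := UniqueFactorizationMonoid.dvd_of_mem_normalizedFactors hp'
    have hprod : p' * (μ / p') = μ := EuclideanDomain.mul_div_cancel' hirr.ne_zero hdvd
    obtain ⟨e', he'⟩ := hass.symm.dvd.trans hpe
    have hq' : μ / p' = e' * EuclideanDomain.gcd q μ := by
      refine mul_left_cancel₀ hirr.ne_zero ?_
      calc p' * (μ / p') = EuclideanDomain.gcd q μ * e := hprod.trans he
        _ = _ := by rw [he']; ring
    refine hv (Set.mem_biUnion (Finset.mem_image.2 ⟨p', Multiset.mem_toFinset.2 hp', rfl⟩) ?_)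
    rw [SetLike.mem_coe, LinearMap.mem_ker, hq', map_mul, Module.End.mul_apply, hd, map_zero]

end Cyclic

/-! ### Separability of f(x,1) -/

/-- The resultant of f(x,1) and its derivative is ±f₀Δ(f), and a nonzero resultant means coprime. -/
theorem separable_of_disc_ne_zero {f : Form n} (hn : 2 ≤ n) (hf0 : f 0 ≠ 0) (hd : disc f ≠ 0) :
    ((dehom f).map (Int.castRingHom ℚ)).Separable := by
  have hdeg := natDegree_dehom hf0
  have hres := Polynomial.resultant_deriv (f := dehom f)
    (Polynomial.natDegree_pos_iff_degree_pos.1 (by omega))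
  have hne : (dehom f).resultant (dehom f).derivative (dehom f).natDegree
      ((dehom f).natDegree - 1) ≠ 0 := by
    rw [hres]
    exact mul_ne_zero (mul_ne_zero (pow_ne_zero _ (by norm_num))
      (Polynomial.leadingCoeff_ne_zero.2 (dehom_ne_zero hf0))) hd
  rw [Polynomial.separable_def]
  by_contra hcop
  have h0 := (Polynomial.resultant_eq_zero_iff (K := ℚ)).2
    ⟨Or.inl (dehom_map_ne_zero hf0), hcop⟩
  rw [Polynomial.derivative_map, Polynomial.natDegree_map_eq_of_injective (RingHom.injective_int _),
    Polynomial.natDegree_map_eq_of_injective (RingHom.injective_int _),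
    Polynomial.resultant_map_map, Polynomial.natDegree_derivative] at h0
  exact hne ((map_eq_zero_iff _ (RingHom.injective_int (Int.castRingHom ℚ))).1 h0)

/-! ### Specializations of the invariant form -/

theorem det_eq_sum_of_invariant {f : Form n} {v : SymPair n} (hv : v.invariant = toPoly f)
    {R : Type*} [CommRing R] (x y : R) :
    (-1) ^ (n * (n - 1) / 2) *
        (x • v.A.map (Int.castRingHom R) - y • v.B.map (Int.castRingHom R)).det =
      ∑ i ∈ Finset.range (n + 1), (cf f i : R) * x ^ (n - i) * y ^ i := by
  have h := congrArg (MvPolynomial.eval₂Hom (Int.castRingHom R) ![x, y]) hv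
  unfold SymPair.invariant toPoly at h
  rw [map_mul, map_pow, map_neg, map_one, RingHom.map_det, map_sum] at h
  convert h using 3
  · ext i j
    simp [-MvPolynomial.coe_eval₂Hom]
  · simp [-MvPolynomial.coe_eval₂Hom]

theorem det_A_of_invariant {f : Form n} {v : SymPair n} (hv : v.invariant = toPoly f) :
    (-1) ^ (n * (n - 1) / 2) * v.A.det = f 0 := by
  have h := det_eq_sum_of_invariant hv (1 : ℤ) 0
  rw [Finset.sum_eq_single 0] at h
  · simpa [cf_zero] using h
  · intro i _ hi
    simp [hi]
  · simp

theorem det_A_ne_zero {f : Form n} (hf0 : f 0 ≠ 0) {v : SymPair n} (hv : v.invariant = toPoly f) :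
    v.A.det ≠ 0 := fun h => hf0 (by rw [← det_A_of_invariant hv, h, mul_zero])

theorem det_X_of_invariant {f : Form n} {v : SymPair n} (hv : v.invariant = toPoly f)
    (R : Type*) [CommRing R] :
    (-1) ^ (n * (n - 1) / 2) * ((Polynomial.X : Polynomial R) •
        v.A.map (Int.castRingHom (Polynomial R)) - v.B.map (Int.castRingHom (Polynomial R))).det =
      (dehom f).map (Int.castRingHom R) := by
  have h := det_eq_sum_of_invariant hv (Polynomial.X : Polynomial R) 1
  rw [one_smul] at h
  rw [h, dehom, Polynomial.map_sum]
  refine Finset.sum_congr rfl fun i _ => ?_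
  simp

/-! ### Integrality of the action of `R_f` -/

theorem coeff_matrix_mul_linear (D : Matrix (Fin n) (Fin n) (Polynomial ℤ))
    (A B : Matrix (Fin n) (Fin n) ℤ) (j : ℕ) :
    (D * ((Polynomial.X : Polynomial ℤ) • A.map (Int.castRingHom (Polynomial ℤ)) -
        B.map (Int.castRingHom (Polynomial ℤ)))).map (fun p => p.coeff (j + 1)) =
      D.map (fun p => p.coeff j) * A - D.map (fun p => p.coeff (j + 1)) * B := by
  ext i k
  simp only [Matrix.map_apply, Matrix.mul_apply, Matrix.sub_apply, Matrix.smul_apply, smul_eq_mul,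
    Polynomial.finsetSum_coeff, ← Finset.sum_sub_distrib]
  refine Finset.sum_congr rfl fun l _ => ?_
  have : D i l * (Polynomial.X * Int.castRingHom (Polynomial ℤ) (A l k) -
      Int.castRingHom (Polynomial ℤ) (B l k)) =
      D i l * Polynomial.X * Polynomial.C (A l k) - D i l * Polynomial.C (B l k) := by
    simp
    ring
  rw [this, Polynomial.coeff_sub, Polynomial.coeff_mul_C, Polynomial.coeff_mul_C,
    Polynomial.coeff_mul_X]

/-- The coefficients `D_j` of `± adj(xA - B)` satisfy `D_j A = D_{j+1} B + f_{n-1-j}`, with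
`D_n = 0`. -/
theorem exists_adjugate_coeff {f : Form n} (hf0 : f 0 ≠ 0) {v : SymPair n}
    (hv : v.invariant = toPoly f) :
    ∃ D : ℕ → Matrix (Fin n) (Fin n) ℤ, D n = 0 ∧
      ∀ j < n, D j * v.A = D (j + 1) * v.B + (cf f (n - 1 - j)) • 1 := by
  set P := (Polynomial.X : Polynomial ℤ) • v.A.map (Int.castRingHom (Polynomial ℤ)) -
    v.B.map (Int.castRingHom (Polynomial ℤ)) with hP
  set D := ((-1 : Polynomial ℤ) ^ (n * (n - 1) / 2)) • P.adjugate with hD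
  have hDP : D * P = dehom f • 1 := by
    rw [hD, Matrix.smul_mul, Matrix.adjugate_mul, smul_smul, hP, det_X_of_invariant hv ℤ]
    congr 1
    exact Polynomial.map_id
  let Dj : ℕ → Matrix (Fin n) (Fin n) ℤ := fun j => D.map fun p => p.coeff j
  have hrec : ∀ j, Dj j * v.A = Dj (j + 1) * v.B + ((dehom f).coeff (j + 1)) • 1 := by
    intro j
    have h := coeff_matrix_mul_linear D v.A v.B j
    rw [← hP, hDP] at h
    have h' : (dehom f • (1 : Matrix (Fin n) (Fin n) (Polynomial ℤ))).map
        (fun p => p.coeff (j + 1)) = ((dehom f).coeff (j + 1)) • 1 := by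
      ext i k
      simp only [Matrix.map_apply, Matrix.smul_apply, Matrix.one_apply, smul_eq_mul]
      split_ifs <;> simp
    rw [h'] at h
    change D.map (fun p => p.coeff j) * v.A = _
    rw [h]
    abel
  -- The bound on the degree of the adjugate comes from the recursion: for j ≥ n it reads D_j A =
  -- D_{j+1} B, so vanishing descends from large j, as A is cancellable.
  have hcancel : ∀ M : Matrix (Fin n) (Fin n) ℤ, M * v.A = 0 → M = 0 := by
    intro M hM
    have h1 : v.A.det • M = 0 := by
      rw [← Matrix.mul_one M, ← Matrix.mul_smul, ← Matrix.mul_adjugate, ← Matrix.mul_assoc, hM,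
        Matrix.zero_mul]
    exact (smul_eq_zero.1 h1).resolve_left (det_A_ne_zero hf0 hv)
  obtain ⟨N, hN⟩ : ∃ N, ∀ j ≥ N, Dj j = 0 := by
    refine ⟨(Finset.univ.sup fun i => Finset.univ.sup fun k => (D i k).natDegree) + 1,
      fun j hj => ?_⟩
    ext i k
    refine Polynomial.coeff_eq_zero_of_natDegree_lt (lt_of_lt_of_le (Nat.lt_succ_of_le ?_) hj)
    exact (Finset.le_sup (f := fun k => (D i k).natDegree) (Finset.mem_univ k)).trans
      (Finset.le_sup (f := fun i => Finset.univ.sup fun k => (D i k).natDegree) (Finset.mem_univ i))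
  have hzero : ∀ m, ∀ j, n ≤ j → N ≤ j + m → Dj j = 0 := by
    intro m
    induction m with
    | zero => intro j _ hj; exact hN j hj
    | succ m ih =>
      intro j hnj hj
      refine hcancel _ ?_
      rw [hrec, ih (j + 1) (by omega) (by omega), Polynomial.coeff_eq_zero_of_natDegree_lt
        (by have := natDegree_dehom_le f; omega)]
      simp
  refine ⟨Dj, hzero N n le_rfl (by omega), fun j hj => ?_⟩
  rw [hrec, coeff_dehom f (by omega)]
  congr 3
  omega

/-- For l = φ(·/α) and x = θ this reads A[θ] = B, where [θ] is the matrix of multiplication by θ. -/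
theorem gram_mul_leftMulMatrix {f : Form n} (l : L f →ₗ[ℚ] ℚ) (w : Module.Basis (Fin n) ℚ (L f))
    (x : L f) : (Matrix.of fun i j => l (w i * w j)) * Algebra.leftMulMatrix w x =
      Matrix.of fun i j => l (x * (w i * w j)) := by
  ext i j
  have h : x * (w i * w j) = ∑ k, Algebra.leftMulMatrix w x k j • (w i * w k) := by
    have : x * w j = ∑ k, Algebra.leftMulMatrix w x k j • w k := by
      simp only [Algebra.leftMulMatrix_eq_repr_mul, Module.Basis.sum_repr]
    rw [mul_left_comm, this, Finset.mul_sum]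
    exact Finset.sum_congr rfl fun k _ => mul_smul_comm _ _ _
  simp only [Matrix.mul_apply, Matrix.of_apply]
  rw [h, map_sum]
  refine Finset.sum_congr rfl fun k _ => ?_
  rw [map_smul, smul_eq_mul, mul_comm]

/-- The matrix is D_{n-1-k} A: since B = A[θ], the recursion of the adjugate coefficients D_j is the
recursion ζ_{k+1} + f_{k+1} = θ(ζ_k + f_k) + f_{k+1}, and D_n = 0 gives the start f₀. -/
theorem leftMulMatrix_zeta {f : Form n} {hf0 : f 0 ≠ 0} {α : (L f)ˣ}
    {w : Module.Basis (Fin n) ℚ (L f)} {v : SymPair n} (h : IsPhiGram f hf0 α w v)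
    (hv : v.invariant = toPoly f) {k : ℕ} (hk : k < n) :
    ∃ M : Matrix (Fin n) (Fin n) ℤ,
      Algebra.leftMulMatrix w (zeta f k + (cf f k : L f)) = M.map (Int.castRingHom ℚ) := by
  obtain ⟨D, hDn, hD⟩ := exists_adjugate_coeff hf0 hv
  have hB : v.A.map (Int.castRingHom ℚ) * Algebra.leftMulMatrix w (theta f) =
      v.B.map (Int.castRingHom ℚ) := by
    have h1 := gram_mul_leftMulMatrix
      (phi f hf0 ∘ₗ LinearMap.mulLeft ℚ ((α⁻¹ : (L f)ˣ) : L f)) w (theta f)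
    convert h1 using 2
    · ext i j
      simpa using (h i j).1
    · ext i j
      rw [Matrix.of_apply, LinearMap.comp_apply, LinearMap.mulLeft_apply, mul_left_comm]
      simpa using (h i j).2
  have hint : ∀ m : ℤ, Algebra.leftMulMatrix w (m : L f) =
      (m • (1 : Matrix (Fin n) (Fin n) ℤ)).map (Int.castRingHom ℚ) := by
    intro m
    rw [map_intCast]
    ext i j
    simp [Matrix.intCast_apply, -zsmul_eq_mul]
  have key : ∀ k < n, Algebra.leftMulMatrix w (zeta f k + (cf f k : L f)) =
      (D (n - 1 - k) * v.A).map (Int.castRingHom ℚ) := by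
    intro k
    induction k with
    | zero =>
      intro hk
      rw [hD _ (by omega), Nat.sub_zero, Nat.sub_add_cancel (by omega), hDn, Matrix.zero_mul,
        zero_add, zeta_zero, zero_add, hint, Nat.sub_self]
    | succ k ih =>
      intro hk
      rw [zeta_succ, mul_comm, map_add, map_mul, ih (by omega), hD (n - 1 - (k + 1)) (by omega),
        hint, (by omega : n - 1 - (k + 1) + 1 = n - 1 - k),
        (by omega : n - 1 - (n - 1 - (k + 1)) = k + 1), Matrix.map_mul, Matrix.mul_assoc, hB,
        ← Matrix.map_mul, ← Matrix.map_add _ (map_add _)]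
  exact ⟨_, key k hk⟩

theorem mul_mem_span_of_isPhiGram {f : Form n} {hf0 : f 0 ≠ 0} {α : (L f)ˣ}
    {w : Module.Basis (Fin n) ℚ (L f)} {v : SymPair n} (h : IsPhiGram f hf0 α w v)
    (hv : v.invariant = toPoly f) {x y : L f} (hx : x ∈ ringSpan f)
    (hy : y ∈ Submodule.span ℤ (Set.range w)) : x * y ∈ Submodule.span ℤ (Set.range w) := by
  have hgen : ∀ k < n, ∀ i, (zeta f k + (cf f k : L f)) * w i ∈ Submodule.span ℤ (Set.range w) := by
    intro k hk i
    obtain ⟨M, hM⟩ := leftMulMatrix_zeta h hv hk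
    have : (zeta f k + (cf f k : L f)) * w i = ∑ l, M l i • w l := by
      rw [← w.sum_repr ((zeta f k + (cf f k : L f)) * w i)]
      refine Finset.sum_congr rfl fun l _ => ?_
      rw [← Algebra.leftMulMatrix_eq_repr_mul, hM, Matrix.map_apply, eq_intCast,
        Int.cast_smul_eq_zsmul]
    rw [this]
    exact Submodule.sum_mem _ fun l _ => Submodule.smul_mem _ _ (Submodule.subset_span ⟨l, rfl⟩)
  induction hy using Submodule.span_induction with
  | mem y hy =>
    obtain ⟨i, rfl⟩ := hy
    have hle : ringSpan f ≤ (Submodule.span ℤ (Set.range w)).comap (LinearMap.mulRight ℤ (w i)) := by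
      unfold ringSpan
      refine Submodule.span_le.2 ?_
      rintro _ (rfl | ⟨k, hk, rfl⟩)
      · change 1 * w i ∈ Submodule.span ℤ (Set.range w)
        rw [one_mul]
        exact Submodule.subset_span ⟨i, rfl⟩
      · change zeta f k * w i ∈ Submodule.span ℤ (Set.range w)
        have : zeta f k * w i = (zeta f k + (cf f k : L f)) * w i - (cf f k : L f) * w i := by ring
        rw [this]
        exact sub_mem (hgen k hk.2 i) (intCast_mul_mem _ _ (Submodule.subset_span ⟨i, rfl⟩))
    exact hle hx
  | zero => rw [mul_zero]; exact zero_mem _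
  | add y z _ _ hy hz => rw [mul_add]; exact add_mem hy hz
  | smul a y _ hy => rw [mul_smul_comm]; exact Submodule.smul_mem _ _ hy

/-- By duality only integrality of φ has to be checked: stability under R_f writes φ(x w_i w_j/α) as
an integral combination of entries of A, and φ(θ w_i w_j/α) is an entry of B. -/
theorem mem_natSpan_of_isPhiGram {f : Form n} {hf0 : f 0 ≠ 0} (hn : 2 ≤ n) {α : (L f)ˣ}
    {w : Module.Basis (Fin n) ℚ (L f)} {v : SymPair n} (h : IsPhiGram f hf0 α w v)
    (hv : v.invariant = toPoly f) (i j : Fin n) :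
    ((α⁻¹ : (L f)ˣ) : L f) * (w i * w j) ∈ natSpan f ((n : ℤ) - 3) := by
  refine mem_natSpan_of_phi_int f hf0 hn (fun x hx => ?_) ⟨v.B i j, ((h i j).2).symm⟩
  obtain ⟨c, hc⟩ := (Submodule.mem_span_range_iff_exists_fun ℤ).1
    (mul_mem_span_of_isPhiGram h hv hx (Submodule.subset_span ⟨i, rfl⟩))
  refine ⟨∑ k, c k * v.A k j, ?_⟩
  have : ((α⁻¹ : (L f)ˣ) : L f) * (w i * w j) * x =
      ∑ k, c k • (((α⁻¹ : (L f)ˣ) : L f) * (w k * w j)) := by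
    calc _ = ((α⁻¹ : (L f)ˣ) : L f) * ((x * w i) * w j) := by ring
      _ = _ := by
        rw [← hc, Finset.sum_mul, Finset.mul_sum]
        exact Finset.sum_congr rfl fun k _ => by rw [smul_mul_assoc, mul_smul_comm]
  rw [this, map_sum]
  push_cast
  refine Finset.sum_congr rfl fun k _ => ?_
  rw [map_zsmul, ← (h k j).1, zsmul_eq_mul]

/-! ### Realizing a pair of matrices -/

/-- Take determinants in A(x - S) = xA - B, with det A = ±f₀. -/
theorem charpoly_of_invariant {f : Form n} {v : SymPair n} (hv : v.invariant = toPoly f)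
    {S : Matrix (Fin n) (Fin n) ℚ}
    (hS : v.A.map (Int.castRingHom ℚ) * S = v.B.map (Int.castRingHom ℚ)) :
    Polynomial.C (f 0 : ℚ) * S.charpoly = (dehom f).map (Int.castRingHom ℚ) := by
  have hC : ∀ M : Matrix (Fin n) (Fin n) ℤ, M.map (Int.castRingHom (Polynomial ℚ)) =
      (M.map (Int.castRingHom ℚ)).map Polynomial.C := fun M => by
    ext i j : 2
    simp
  have hprod : (v.A.map (Int.castRingHom ℚ)).map Polynomial.C * S.charmatrix =
      (Polynomial.X : Polynomial ℚ) • v.A.map (Int.castRingHom (Polynomial ℚ)) -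
        v.B.map (Int.castRingHom (Polynomial ℚ)) := by
    rw [hC, hC, ← hS, Matrix.map_mul, Matrix.charmatrix, Matrix.mul_sub]
    congr 1
    rw [Matrix.scalar_apply, ← Matrix.smul_one_eq_diagonal, Matrix.mul_smul, Matrix.mul_one]
  have hdet := congrArg Matrix.det hprod
  rw [Matrix.det_mul] at hdet
  rw [← det_X_of_invariant hv ℚ, ← hdet, ← mul_assoc]
  change _ = _ * S.charpoly
  congr 1
  have h1 : ((v.A.map (Int.castRingHom ℚ)).map Polynomial.C).det =
      Polynomial.C ((v.A.det : ℤ) : ℚ) := by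
    rw [← RingHom.mapMatrix_apply, ← RingHom.map_det, ← RingHom.mapMatrix_apply, ← RingHom.map_det]
    rfl
  rw [h1, ← det_A_of_invariant hv]
  push_cast
  simp

theorem exists_isPhiGram {f : Form n} (hn : 2 ≤ n) (hf0 : f 0 ≠ 0) (hd : disc f ≠ 0) {v : SymPair n}
    (hv : v.invariant = toPoly f) :
    ∃ (α : (L f)ˣ) (w : Module.Basis (Fin n) ℚ (L f)), IsPhiGram f hf0 α w v := by
  have hf : (f 0 : ℚ) ≠ 0 := by exact_mod_cast hf0
  have hfin := finiteDimensional_L hf0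
  set A := v.A.map (Int.castRingHom ℚ) with hA
  set B := v.B.map (Int.castRingHom ℚ) with hB
  have hAsymm : A.transpose = A := by rw [hA, ← Matrix.transpose_map, v.symmA.eq]
  have hBsymm : B.transpose = B := by rw [hB, ← Matrix.transpose_map, v.symmB.eq]
  have hAdet : IsUnit A.det := by
    rw [isUnit_iff_ne_zero, hA, ← RingHom.mapMatrix_apply, ← RingHom.map_det,
      eq_intCast]
    exact_mod_cast det_A_ne_zero hf0 hv
  set S := A⁻¹ * B with hS
  have hAS : A * S = B := by rw [hS, Matrix.mul_nonsing_inv_cancel_left _ _ hAdet]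
  have hSA : S.transpose * A = B := by
    conv_lhs => rw [← hAsymm]
    rw [← Matrix.transpose_mul, hAS, hBsymm]
  have hchar := charpoly_of_invariant hv hAS
  have hassoc : Associated S.charpoly ((dehom f).map (Int.castRingHom ℚ)) := by
    rw [← hchar]
    exact associated_unit_mul_right _ _ (Polynomial.isUnit_C.2 (isUnit_iff_ne_zero.2 hf))
  have hsep : S.charpoly.Separable := (separable_of_disc_ne_zero hn hf0 hd).of_dvd hassoc.dvd
  set T := Matrix.toLin' S with hT
  obtain ⟨c, hc⟩ := exists_cyclic_vector T
  rw [hT, Matrix.minpoly_toLin', minpoly_eq_charpoly_of_separable S hsep, ← hT] at hc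
  -- The map p ↦ p(S)c descends to L, since f(x,1) is a multiple of the characteristic polynomial,
  -- and is injective there because c is cyclic.
  let Ψ : Polynomial ℚ →ₗ[ℚ] (Fin n → ℚ) :=
    (LinearMap.applyₗ c).comp (Polynomial.aeval T).toLinearMap
  have hker : (Ideal.span {(dehom f).map (Int.castRingHom ℚ)}).restrictScalars ℚ ≤
      LinearMap.ker Ψ := by
    intro p hp
    obtain ⟨q, rfl⟩ := Ideal.mem_span_singleton.1 hp
    change Polynomial.aeval T _ c = 0
    have h0 : Polynomial.aeval T S.charpoly = 0 := by
      rw [hT, ← Matrix.charpoly_toLin']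
      exact LinearMap.aeval_self_charpoly _
    rw [← hchar, mul_right_comm, map_mul, h0, mul_zero, LinearMap.zero_apply]
  let χ₀ : L f →ₗ[ℚ] (Fin n → ℚ) := (Submodule.liftQ _ Ψ hker).comp
    (Submodule.Quotient.restrictScalarsEquiv ℚ
      (Ideal.span {(dehom f).map (Int.castRingHom ℚ)})).symm.toLinearMap
  have hχ₀ : ∀ p, χ₀ (AdjoinRoot.mk _ p) = Polynomial.aeval T p c := fun p => rfl
  have hinj : Function.Injective χ₀ := by
    rw [← LinearMap.ker_eq_bot, LinearMap.ker_eq_bot']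
    intro z hz
    obtain ⟨p, rfl⟩ := AdjoinRoot.mk_surjective z
    rw [hχ₀] at hz
    exact AdjoinRoot.mk_eq_zero.2 (hassoc.symm.dvd.trans (hc p hz))
  let χ : L f ≃ₗ[ℚ] (Fin n → ℚ) := LinearMap.linearEquivOfInjective χ₀ hinj
    (by rw [finrank_L hf0, Module.finrank_fin_fun])
  have hθ : ∀ z, χ (theta f * z) = S.mulVec (χ z) := by
    intro z
    obtain ⟨p, rfl⟩ := AdjoinRoot.mk_surjective z
    change χ₀ _ = S.mulVec (χ₀ _)
    have : theta f * AdjoinRoot.mk _ p = AdjoinRoot.mk _ (Polynomial.X * p) := by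
      rw [map_mul, AdjoinRoot.mk_X]; rfl
    rw [this, hχ₀, hχ₀, map_mul, Polynomial.aeval_X, Module.End.mul_apply, hT, Matrix.toLin'_apply]
  let l : L f →ₗ[ℚ] L f →ₗ[ℚ] ℚ :=
    (Matrix.toLinearMap₂' ℚ A).compl₁₂ (χ : L f →ₗ[ℚ] (Fin n → ℚ)) (χ : L f →ₗ[ℚ] (Fin n → ℚ))
  have hl : ∀ x y, l x y = χ x ⬝ᵥ A.mulVec (χ y) := fun x y => by
    simp [l, Matrix.toLinearMap₂'_apply']
  have hlθ : ∀ x y, l (theta f * x) y = χ x ⬝ᵥ B.mulVec (χ y) := by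
    intro x y
    rw [hl, hθ, ← Matrix.vecMul_transpose, ← Matrix.dotProduct_mulVec, Matrix.mulVec_mulVec, hSA]
  -- SᵗA = B = AS: θ is self-adjoint for the form of A, so that form depends only on the product xy.
  have hlθ' : ∀ x y, l (theta f * x) y = l x (theta f * y) := by
    intro x y
    rw [hlθ, hl, hθ, Matrix.mulVec_mulVec, hAS]
  have hlpow : ∀ k x, l x (theta f ^ k) = l (x * theta f ^ k) 1 := by
    intro k
    induction k with
    | zero => intro x; rw [pow_zero, mul_one]
    | succ k ih =>
      intro x
      rw [pow_succ', ← hlθ', ih]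
      congr 2
      ring
  have hlmul : ∀ x y, l x y = l (x * y) 1 := by
    intro x y
    have : l x = (l.flip 1) ∘ₗ LinearMap.mulLeft ℚ x :=
      (thetaBasis f hf0).ext fun k => by
        rw [thetaBasis_apply, hlpow]
        rfl
    rw [this]
    rfl
  obtain ⟨β, hβ⟩ := exists_eq_phi_mul f hf0 (l.flip 1)
  have hβ' : ∀ x y, l x y = phi f hf0 (β * (x * y)) := fun x y => by rw [hlmul, ← hβ]; rfl
  -- If βz = 0 then z lies in the radical of the form of A, which is zero; so β is a unit and α =
  -- β⁻¹.
  have hβinj : Function.Injective (LinearMap.mulLeft ℚ β) := by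
    rw [← LinearMap.ker_eq_bot, LinearMap.ker_eq_bot']
    intro z hz
    rw [LinearMap.mulLeft_apply] at hz
    have h0 : A.mulVec (χ z) = 0 := by
      ext i
      have h1 := hβ' (χ.symm (Pi.single i 1)) z
      rw [mul_left_comm, hz, mul_zero, map_zero, hl, LinearEquiv.apply_symm_apply,
        single_dotProduct, one_mul] at h1
      exact h1
    have h2 : χ z = 0 := by
      have := congrArg A⁻¹.mulVec h0
      rwa [Matrix.mulVec_mulVec, Matrix.nonsing_inv_mul _ hAdet, Matrix.one_mulVec,
        Matrix.mulVec_zero] at this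
    exact χ.map_eq_zero_iff.1 h2
  obtain ⟨β', hββ'⟩ := LinearMap.surjective_of_injective hβinj 1
  rw [LinearMap.mulLeft_apply] at hββ'
  let w : Module.Basis (Fin n) ℚ (L f) := Module.Basis.ofEquivFun χ
  have hw : ∀ i, χ (w i) = Pi.single i 1 := fun i => by simp [w]
  refine ⟨⟨β', β, by rw [mul_comm, hββ'], hββ'⟩, w, fun i j => ?_⟩
  change _ = phi f hf0 (β * _) ∧ _ = phi f hf0 (theta f * (β * _))
  constructor
  · rw [← hβ', hl, hw, hw]
    simp [hA]
  · have : theta f * (β * (w i * w j)) = β * (theta f * w i * w j) := by ring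
    rw [this, ← hβ', hlθ, hw, hw]
    simp [hB]

/-! ### Pairs `(I, α)` and their Gram data -/

theorem mem_units_smul {f : Form n} {κ : (L f)ˣ} {I : Submodule (order f) (L f)} {x : L f} :
    x ∈ κ • I ↔ ∃ y ∈ I, (κ : L f) * y = x :=
  Submodule.mem_smul_pointwise_iff_exists _ _ _

theorem inv_mul_mem_natSpan {f : Form n} (hf0 : f 0 ≠ 0) (hn : 2 ≤ n) (p : IdealPair f) {x y : L f}
    (hx : x ∈ p.I) (hy : y ∈ p.I) :
    ((p.α⁻¹ : (L f)ˣ) : L f) * (x * y) ∈ natSpan f ((n : ℤ) - 3) := by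
  obtain ⟨z, hz, hzx⟩ := mem_units_smul.1 (p.sq_le (Submodule.mul_mem_mul hx hy))
  rw [← hzx, Units.inv_mul_cancel_left, natSpan_eq_idealPow f hf0 hn]
  exact hz

theorem exists_coeff_of_mem_natSpan {f : Form n} {k : ℤ} {z : L f} (hz : z ∈ natSpan f k) :
    ∃ c : ℕ → ℤ, z = ∑ i ∈ Finset.range n, c i • natBasis f k i := by
  obtain ⟨c, hc⟩ := (Submodule.mem_span_range_iff_exists_fun ℤ).1 hz
  refine ⟨fun i => if h : i < n then c ⟨i, h⟩ else 0, ?_⟩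
  rw [Finset.sum_range, ← hc]
  simp

theorem phi_sum_zsmul_natBasis (f : Form n) (hf0 : f 0 ≠ 0) (hn : 2 ≤ n) (c : ℕ → ℤ) :
    phi f hf0 (∑ k ∈ Finset.range n, c k • natBasis f ((n : ℤ) - 3) k) = c (n - 1) ∧
    phi f hf0 (theta f * ∑ k ∈ Finset.range n, c k • natBasis f ((n : ℤ) - 3) k) = c (n - 2) := by
  have h := phi_sum_natBasis f hf0 hn fun k => (c k : ℚ)
  simp only [Int.cast_smul_eq_zsmul] at h
  exact h

theorem isGram_iff {f : Form n} (hf0 : f 0 ≠ 0) (hn : 2 ≤ n) (p : IdealPair f)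
    (b : Module.Basis (Fin n) ℤ p.I) (v : SymPair n) :
    IsGram p b v ↔ IsPhiGram f hf0 p.α (fun i => (b i : L f)) v := by
  refine forall_congr' fun i => forall_congr' fun j => ?_
  constructor
  · rintro ⟨c, hc, hA, hB⟩
    obtain ⟨h1, h2⟩ := phi_sum_zsmul_natBasis f hf0 hn c
    rw [hc, h1, h2, hA, hB]
    exact ⟨rfl, rfl⟩
  · rintro ⟨hA, hB⟩
    obtain ⟨c, hc⟩ := exists_coeff_of_mem_natSpan
      (inv_mul_mem_natSpan hf0 hn p (b i).2 (b j).2)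
    obtain ⟨h1, h2⟩ := phi_sum_zsmul_natBasis f hf0 hn c
    rw [hc, h1] at hA
    rw [hc, h2] at hB
    exact ⟨c, hc, by exact_mod_cast hA, by exact_mod_cast hB⟩

/-- `(A, B)` is the Gram data of an oriented basis of `(I, α)`. -/
def Corresponds {f : Form n} (v : SymPair n) (p : IdealPair f) : Prop :=
  ∃ b : Module.Basis (Fin n) ℤ p.I, HasOrientation f (fun i => (b i : L f)) p.ε ∧ IsGram p b v

/-- The working form of the correspondence: a ℤ-basis of I is replaced by a ℚ-basis of L spanning I
over ℤ, for which determinants are available. -/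
theorem corresponds_iff {f : Form n} (hf0 : f 0 ≠ 0) (hn : 2 ≤ n) (v : SymPair n)
    (p : IdealPair f) :
    Corresponds v p ↔ ∃ w : Module.Basis (Fin n) ℚ (L f),
      p.I.restrictScalars ℤ = Submodule.span ℤ (Set.range w) ∧
      0 < ((p.ε : ℤ) : ℚ) * (natBasisQ f hf0 0).det w ∧ IsPhiGram f hf0 p.α w v := by
  constructor
  · rintro ⟨b, ho, hg⟩
    obtain ⟨w, hw, hspan⟩ := exists_basisQ hf0 b
    have hwb : ⇑w = fun i => (b i : L f) := funext hw
    rw [hasOrientation_iff f hf0] at ho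
    rw [isGram_iff hf0 hn] at hg
    exact ⟨w, hspan, hwb ▸ ho, hwb ▸ hg⟩
  · rintro ⟨w, hspan, ho, hg⟩
    obtain ⟨b, hb⟩ := exists_basis_of_span w hspan
    have hwb : ⇑w = fun i => (b i : L f) := funext fun i => (hb i).symm
    refine ⟨b, ?_, ?_⟩
    · rw [hasOrientation_iff f hf0, ← hwb]
      exact ho
    · rw [isGram_iff hf0 hn, ← hwb]
      exact hg

theorem exists_oriented_basis {f : Form n} (hf0 : f 0 ≠ 0) (hn : 2 ≤ n) (p : IdealPair f) :
    ∃ w : Module.Basis (Fin n) ℚ (L f),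
      p.I.restrictScalars ℤ = Submodule.span ℤ (Set.range w) ∧
      0 < ((p.ε : ℤ) : ℚ) * (natBasisQ f hf0 0).det w := by
  have := p.free
  have : Module.Finite ℤ p.I := Module.finite_of_finrank_pos (by rw [p.rank]; omega)
  obtain ⟨w, -, hspan⟩ := exists_basisQ hf0 (Module.finBasisOfFinrankEq ℤ p.I p.rank)
  have hdet : (natBasisQ f hf0 0).det w ≠ 0 := ((natBasisQ f hf0 0).isUnit_det w).ne_zero
  have hε : ((p.ε : ℤ) : ℚ) ≠ 0 := by exact_mod_cast p.ε.ne_zero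
  rcases lt_or_gt_of_ne (mul_ne_zero hε hdet) with h | h
  -- With the wrong orientation, the first basis vector is negated.
  · let d : Fin n → ℤ := Function.update 1 ⟨0, by omega⟩ (-1)
    have hd : (Matrix.diagonal d).det = -1 := by
      rw [Matrix.det_diagonal, Finset.prod_update_of_mem (Finset.mem_univ _)]
      simp
    have hdd : Matrix.diagonal d * Matrix.diagonal d = 1 := by
      rw [Matrix.diagonal_mul_diagonal, ← Matrix.diagonal_one]
      congr 1
      ext i
      by_cases hi : i = ⟨0, by omega⟩
      · simp [d, hi]
      · simp [d, hi]
    obtain ⟨w', hw'⟩ := exists_act_basis w (g := Matrix.diagonal d) (by rw [hd]; norm_num)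
    refine ⟨w', ?_, ?_⟩
    · rw [hspan, hw']
      refine le_antisymm ?_ (span_act_le _ _)
      conv_lhs => rw [← act_one w, ← hdd, act_mul]
      exact span_act_le _ _
    · rw [hw', det_act, hd]
      push_cast
      linarith
  · exact ⟨w, hspan, h⟩

theorem det_sq_of_idealPair {f : Form n} (hf0 : f 0 ≠ 0) (hn : 2 ≤ n) (p : IdealPair f)
    {w : Module.Basis (Fin n) ℚ (L f)}
    (h : p.I.restrictScalars ℤ = Submodule.span ℤ (Set.range w)) :
    (natBasisQ f hf0 0).det w ^ 2 =
      Algebra.norm ℚ (p.α : L f) / (f 0 : ℚ) ^ ((n : ℤ) - 3) := by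
  rw [← p.norm_sq, idealNorm_eq f hf0 (by omega) p.I w h, mul_pow, sq_abs]
  rcases Int.units_eq_one_or p.ε with h | h <;> simp [h]

/-- The inclusion I² ⊆ αI_f^{n-3} makes the values of φ integers, and the norm condition gives the
invariant form. -/
theorem exists_corresponds_of_idealPair {f : Form n} (hf0 : f 0 ≠ 0) (hn : 2 ≤ n)
    (p : IdealPair f) : ∃ v : WithInvariant f, Corresponds v.1 p := by
  obtain ⟨w, hspan, ho⟩ := exists_oriented_basis hf0 hn p
  have hmem : ∀ i, w i ∈ p.I := fun i => by
    have : w i ∈ p.I.restrictScalars ℤ := hspan ▸ Submodule.subset_span ⟨i, rfl⟩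
    exact this
  have hint : ∀ i j, ∃ a b : ℤ,
      (a : ℚ) = phi f hf0 (((p.α⁻¹ : (L f)ˣ) : L f) * (w i * w j)) ∧
      (b : ℚ) = phi f hf0 (theta f * (((p.α⁻¹ : (L f)ˣ) : L f) * (w i * w j))) := by
    intro i j
    obtain ⟨c, hc⟩ := exists_coeff_of_mem_natSpan (inv_mul_mem_natSpan hf0 hn p (hmem i) (hmem j))
    obtain ⟨h1, h2⟩ := phi_sum_zsmul_natBasis f hf0 hn c
    exact ⟨_, _, by rw [hc, h1], by rw [hc, h2]⟩
  choose A B hAB using hint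
  let v : SymPair n :=
    { A := Matrix.of A
      B := Matrix.of B
      symmA := by
        ext i j
        have := (hAB j i).1
        rw [mul_comm (w j), ← (hAB i j).1] at this
        exact_mod_cast this
      symmB := by
        ext i j
        have := (hAB j i).2
        rw [mul_comm (w j), ← (hAB i j).2] at this
        exact_mod_cast this }
  have hg : IsPhiGram f hf0 p.α w v := hAB
  exact ⟨⟨v, (invariant_iff hn hg).2 (det_sq_of_idealPair hf0 hn p hspan)⟩,
    (corresponds_iff hf0 hn _ _).2 ⟨w, hspan, ho, hg⟩⟩

theorem exists_corresponds_of_withInvariant {f : Form n} (hf0 : f 0 ≠ 0) (hn : 2 ≤ n)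
    (hd : disc f ≠ 0) (v : WithInvariant f) : ∃ p : IdealPair f, Corresponds v.1 p := by
  obtain ⟨α, w, hg⟩ := exists_isPhiGram hn hf0 hd v.2
  let I : Submodule (order f) (L f) :=
    { Submodule.span ℤ (Set.range w) with
      smul_mem' := fun r x hx => mul_mem_span_of_isPhiGram hg v.2 r.2 hx }
  have hI : I.restrictScalars ℤ = Submodule.span ℤ (Set.range w) := rfl
  obtain ⟨b, -⟩ := exists_basis_of_span w hI
  have hdet : (natBasisQ f hf0 0).det w ≠ 0 := ((natBasisQ f hf0 0).isUnit_det w).ne_zero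
  obtain ⟨ε, hε⟩ : ∃ ε : ℤˣ, 0 < ((ε : ℤ) : ℚ) * (natBasisQ f hf0 0).det w := by
    rcases lt_or_gt_of_ne hdet with h | h
    · exact ⟨-1, by push_cast; linarith⟩
    · exact ⟨1, by push_cast; linarith⟩
  have hsq : I * I ≤ α • idealPow f ((n : ℤ) - 3) := by
    have key : ∀ x ∈ Submodule.span ℤ (Set.range w), ∀ y ∈ Submodule.span ℤ (Set.range w),
        ((α⁻¹ : (L f)ˣ) : L f) * (x * y) ∈ natSpan f ((n : ℤ) - 3) := by
      intro x hx y hy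
      induction hx, hy using Submodule.span_induction₂ with
      | mem_mem x y hx hy =>
        obtain ⟨i, rfl⟩ := hx
        obtain ⟨j, rfl⟩ := hy
        exact mem_natSpan_of_isPhiGram hn hg v.2 i j
      | zero_left y _ => rw [zero_mul, mul_zero]; exact zero_mem _
      | zero_right x _ => rw [mul_zero, mul_zero]; exact zero_mem _
      | add_left x y z _ _ _ h1 h2 => rw [add_mul, mul_add]; exact add_mem h1 h2
      | add_right x y z _ _ _ h1 h2 => rw [mul_add, mul_add]; exact add_mem h1 h2
      | smul_left r x y _ _ h =>
        rw [smul_mul_assoc, mul_smul_comm]; exact Submodule.smul_mem _ _ h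
      | smul_right r x y _ _ h =>
        rw [mul_smul_comm, mul_smul_comm]; exact Submodule.smul_mem _ _ h
    refine Submodule.mul_le.2 fun x hx y hy => ?_
    rw [mem_units_smul]
    have h := key x hx y hy
    rw [natSpan_eq_idealPow f hf0 hn] at h
    exact ⟨_, h, by rw [Units.mul_inv_cancel_left]⟩
  refine ⟨{ I := I, free := Module.Free.of_basis b, rank := ?_, ε := ε, α := α, sq_le := hsq,
            norm_sq := ?_ }, ?_⟩
  · rw [Module.finrank_eq_card_basis b, Fintype.card_fin]
  · rw [← (invariant_iff hn hg).1 v.2, idealNorm_eq f hf0 (by omega) I w hI, mul_pow, sq_abs]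
    rcases Int.units_eq_one_or ε with h | h <;> simp [h]
  · exact (corresponds_iff hf0 hn _ _).2 ⟨w, hI, hε, hg⟩

/-! ### Compatibility with equivalence and with the action -/

theorem smul_restrictScalars {f : Form n} {I : Submodule (order f) (L f)} {w : Fin n → L f}
    (h : I.restrictScalars ℤ = Submodule.span ℤ (Set.range w)) (κ : (L f)ˣ) :
    (κ • I).restrictScalars ℤ = Submodule.span ℤ (Set.range fun i => (κ : L f) * w i) := by
  have h1 : (Set.range fun i => (κ : L f) * w i) =
      LinearMap.mulLeft ℤ (κ : L f) '' Set.range w := by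
    rw [← Set.range_comp]; rfl
  rw [h1, Submodule.span_image, ← h]
  ext x
  rw [Submodule.restrictScalars_mem, mem_units_smul]
  rfl

theorem sign_compatible_iff {ε ε' : ℤˣ} {N d : ℚ} (hN : N ≠ 0) (h : 0 < ((ε : ℤ) : ℚ) * d) :
    0 < ((ε' : ℤ) : ℚ) * (N * d) ↔ (ε' : ℤ) = (SignType.sign N : ℤ) * (ε : ℤ) := by
  have hd : d ≠ 0 := by
    rintro rfl
    simp at h
  rcases Int.units_eq_one_or ε with rfl | rfl <;> rcases Int.units_eq_one_or ε' with rfl | rfl <;>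
    rcases lt_or_gt_of_ne hN with hN | hN <;>
    simp [hN, sign_neg, sign_pos, mul_pos_iff, hN.not_gt] at h ⊢ <;> nlinarith

theorem corresponds_of_equivalent {f : Form n} (hf0 : f 0 ≠ 0) (hn : 2 ≤ n) {v : SymPair n}
    {p q : IdealPair f} (h : Corresponds v p) (hpq : p.Equivalent q) : Corresponds v q := by
  rw [corresponds_iff hf0 hn] at h ⊢
  obtain ⟨w, hspan, ho, hg⟩ := h
  obtain ⟨κ, hI, hε, hα⟩ := hpq
  obtain ⟨w', hw'⟩ := exists_mul_basis w κ
  refine ⟨w', ?_, ?_, ?_⟩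
  · rw [hI, hw', smul_restrictScalars hspan]
  · rw [hw', det_mul_left]
    exact (sign_compatible_iff (κ.isUnit.map (Algebra.norm ℚ)).ne_zero ho).2 hε
  · rw [hw', hα]
    exact isPhiGram_mul hg κ

theorem corresponds_smul {f : Form n} (hf0 : f 0 ≠ 0) (hn : 2 ≤ n) {v : SymPair n}
    {p : IdealPair f} (h : Corresponds v p) (g : Matrix.SpecialLinearGroup (Fin n) ℤ) :
    Corresponds (g • v) p := by
  rw [corresponds_iff hf0 hn] at h ⊢
  obtain ⟨w, hspan, ho, hg⟩ := h
  obtain ⟨w', hw'⟩ := exists_act_basis w (g := g.1) (by rw [g.2]; norm_num)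
  refine ⟨w', ?_, ?_, ?_⟩
  · rw [hw', span_act, hspan]
  · rw [hw', det_act, g.2]
    simpa using ho
  · rw [hw']
    exact isPhiGram_act hg g

theorem equivalent_of_corresponds {f : Form n} (hf0 : f 0 ≠ 0) (hn : 2 ≤ n) {v : SymPair n}
    {p q : IdealPair f} (hp : Corresponds v p) (hq : Corresponds v q) : p.Equivalent q := by
  rw [corresponds_iff hf0 hn] at hp hq
  obtain ⟨w, hspan, ho, hg⟩ := hp
  obtain ⟨w', hspan', ho', hg'⟩ := hq
  obtain ⟨κ, hκ, hα⟩ := exists_unit_of_isPhiGram hg hg'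
  have hw' : ⇑w' = fun i => (κ : L f) * w i := funext hκ
  refine ⟨κ, ?_, ?_, hα⟩
  · apply Submodule.restrictScalars_injective ℤ
    rw [hspan', smul_restrictScalars hspan, hw']
  · rw [hw', det_mul_left] at ho'
    exact (sign_compatible_iff (κ.isUnit.map (Algebra.norm ℚ)).ne_zero ho).1 ho'

theorem exists_smul_eq_of_corresponds {f : Form n} (hf0 : f 0 ≠ 0) (hn : 2 ≤ n)
    {v v' : SymPair n} {p : IdealPair f} (h : Corresponds v p) (h' : Corresponds v' p) :
    ∃ g : Matrix.SpecialLinearGroup (Fin n) ℤ, g • v = v' := by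
  rw [corresponds_iff hf0 hn] at h h'
  obtain ⟨w, hspan, ho, hg⟩ := h
  obtain ⟨w', hspan', ho', hg'⟩ := h'
  obtain ⟨g, hgw⟩ := exists_specialLinear_act _ w w' (hspan.symm.trans hspan') ho ho'
  refine ⟨g, isPhiGram_unique (isPhiGram_act hg g) ?_⟩
  rw [← hgw]
  exact hg'

/-- A relation total on both sides, invariant under both equivalences and separating classes on both
sides is the graph of a bijection of quotients. -/
theorem exists_quotient_equiv {X Y : Type*} (r : Setoid X) (s : Setoid Y) (R : X → Y → Prop)
    (hX : ∀ x, ∃ y, R x y) (hY : ∀ y, ∃ x, R x y)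
    (hr : ∀ x x' y, R x y → R x' y → r x x') (hs : ∀ x y y', R x y → R x y' → s y y')
    (hr' : ∀ x x' y, r x x' → R x y → R x' y) (hs' : ∀ x y y', s y y' → R x y → R x y') :
    ∃ Φ : Quotient r ≃ Quotient s, ∀ x y, Φ (Quotient.mk r x) = Quotient.mk s y ↔ R x y := by
  choose F hF using hX
  let Φ : Quotient r → Quotient s := Quotient.lift (fun x => Quotient.mk s (F x)) fun x x' h =>
    Quotient.sound (hs x' _ _ (hr' x x' _ h (hF x)) (hF x'))
  have hΦ : ∀ x y, Φ (Quotient.mk r x) = Quotient.mk s y ↔ R x y := fun x y =>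
    ⟨fun h => hs' x _ _ (Quotient.exact h) (hF x), fun h => Quotient.sound (hs x _ _ (hF x) h)⟩
  refine ⟨Equiv.ofBijective Φ ⟨?_, ?_⟩, hΦ⟩
  · intro a b
    induction a using Quotient.inductionOn with | _ x =>
    induction b using Quotient.inductionOn with | _ x' =>
    intro h
    exact Quotient.sound (hr x x' (F x') ((hΦ _ _).1 h) (hF x'))
  · intro b
    induction b using Quotient.inductionOn with | _ y =>
    obtain ⟨x, hx⟩ := hY y
    exact ⟨Quotient.mk r x, (hΦ x y).2 hx⟩

theorem exists_orbit_equiv {f : Form n} (hf0 : f 0 ≠ 0) (hn : 2 ≤ n) (hd : disc f ≠ 0) :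
    ∃ Φ : Quotient (orbitSetoid f) ≃ Quotient (pairSetoid f),
      ∀ (v : WithInvariant f) (p : IdealPair f),
        Φ (Quotient.mk (orbitSetoid f) v) = Quotient.mk (pairSetoid f) p ↔ Corresponds v.1 p := by
  refine exists_quotient_equiv _ _ (fun (v : WithInvariant f) (p : IdealPair f) =>
    Corresponds v.1 p) (exists_corresponds_of_withInvariant hf0 hn hd)
    (exists_corresponds_of_idealPair hf0 hn) ?_ ?_ ?_ ?_
  · intro v v' p h h'
    exact exists_smul_eq_of_corresponds hf0 hn h' h
  · intro v p q hp hq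
    exact equivalent_of_corresponds hf0 hn hp hq
  · rintro v v' p ⟨g, hg⟩ h
    have hg : g • v'.1 = v.1 := hg
    have : g⁻¹ • v.1 = v'.1 := by rw [← hg, inv_smul_smul]
    rw [← this]
    exact corresponds_smul hf0 hn h _
  · intro v p q hpq h
    exact corresponds_of_equivalent hf0 hn h hpq

/-! ### Stabilizers -/

/-- The bases w and gw have the same Gram data with the same α, so they differ by a factor κ with
κ²α = α; comparing determinants gives N(κ) = det g = 1. -/
theorem exists_mul_of_mem_stabilizer {f : Form n} {hf0 : f 0 ≠ 0} {α : (L f)ˣ}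
    {w : Module.Basis (Fin n) ℚ (L f)} {v : SymPair n} (h : IsPhiGram f hf0 α w v)
    {g : Matrix.SpecialLinearGroup (Fin n) ℤ} (hg : g • v = v) :
    ∃ u : L f, act g.1 w = (fun i => u * w i) ∧ u ^ 2 = 1 ∧ Algebra.norm ℚ u = 1 := by
  obtain ⟨w', hw'⟩ := exists_act_basis w (g := g.1) (by rw [g.2]; norm_num)
  have h' := isPhiGram_act h g
  rw [hg, ← hw'] at h'
  obtain ⟨κ, hκ, hα⟩ := exists_unit_of_isPhiGram h h'
  have hw'' : ⇑w' = fun i => (κ : L f) * w i := funext hκ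
  refine ⟨κ, by rw [← hw', hw''], ?_, ?_⟩
  · have : κ ^ 2 = 1 := by
      refine mul_right_cancel (b := α) ?_
      rw [← hα, one_mul]
    rw [← Units.val_pow_eq_pow_val, this, Units.val_one]
  · have hdet := det_act w g.1 w
    rw [← hw', hw'', det_mul_left, g.2, Module.Basis.det_self] at hdet
    simpa using hdet

theorem eq_of_mul_basis_eq {f : Form n} (w : Module.Basis (Fin n) ℚ (L f)) {x y : L f}
    (h : (fun i => x * w i) = fun i => y * w i) : x = y := by
  have : LinearMap.mulLeft ℚ x = LinearMap.mulLeft ℚ y := w.ext fun i => congrFun h i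
  have h1 := LinearMap.congr_fun this 1
  simpa using h1

theorem specialLinear_ext_of_act {f : Form n} (w : Module.Basis (Fin n) ℚ (L f))
    {g h : Matrix.SpecialLinearGroup (Fin n) ℤ} (hgh : act g.1 w = act h.1 w) : g = h :=
  Subtype.ext (act_injective w hgh)

theorem act_coe_mul_of_mul {f : Form n} (w : Fin n → L f)
    {g h : Matrix.SpecialLinearGroup (Fin n) ℤ} {x y : L f} (hx : act g.1 w = fun i => x * w i)
    (hy : act h.1 w = fun i => y * w i) : act (g * h).1 w = fun i => (x * y) * w i := by
  rw [Matrix.SpecialLinearGroup.coe_mul, act_mul, hy, act_mul_left, hx]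
  ext i
  ring

theorem sq_eq_one_of_mem_stabilizer {f : Form n} {hf0 : f 0 ≠ 0} {α : (L f)ˣ}
    {w : Module.Basis (Fin n) ℚ (L f)} {v : SymPair n} (h : IsPhiGram f hf0 α w v)
    {g : Matrix.SpecialLinearGroup (Fin n) ℤ} (hg : g • v = v) : g ^ 2 = 1 := by
  obtain ⟨u, hu, hu2, -⟩ := exists_mul_of_mem_stabilizer h hg
  refine specialLinear_ext_of_act w ?_
  rw [pow_two, act_coe_mul_of_mul w hu hu, ← pow_two, hu2, Matrix.SpecialLinearGroup.coe_one,
    act_one]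
  simp

theorem finite_stabilizer {f : Form n} {hf0 : f 0 ≠ 0} {α : (L f)ˣ}
    {w : Module.Basis (Fin n) ℚ (L f)} {v : SymPair n} (h : IsPhiGram f hf0 α w v) :
    Finite (MulAction.stabilizer (Matrix.SpecialLinearGroup (Fin n) ℤ) v) := by
  choose u hu hu2 _ using fun g : MulAction.stabilizer (Matrix.SpecialLinearGroup (Fin n) ℤ) v =>
    exists_mul_of_mem_stabilizer h g.2
  have := finite_sq_eq_one hf0
  refine Finite.of_injective (β := {u : L f // u ^ 2 = 1}) (fun g => ⟨u g, hu2 g⟩) ?_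
  intro g g' hgg
  have : u g = u g' := congrArg Subtype.val hgg
  refine Subtype.ext (specialLinear_ext_of_act w ?_)
  rw [hu, hu, this]

theorem exists_stabilizer_equiv {f : Form n} {hf0 : f 0 ≠ 0} {α : (L f)ˣ}
    {w : Module.Basis (Fin n) ℚ (L f)} {v : SymPair n} (h : IsPhiGram f hf0 α w v)
    {I : Submodule (order f) (L f)} (hI : I.restrictScalars ℤ = Submodule.span ℤ (Set.range w)) :
    ∃ e : MulAction.stabilizer (Matrix.SpecialLinearGroup (Fin n) ℤ) v ≃*
        twoTorsionNormOne (endRing I),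
      ∀ g, (fun i => (((e g : (endRing I)ˣ) : endRing I) : L f) * w i) =
        act (g : Matrix.SpecialLinearGroup (Fin n) ℤ).1 w := by
  have hmem : ∀ x, x ∈ I ↔ x ∈ Submodule.span ℤ (Set.range w) := fun x => by rw [← hI]; rfl
  choose u hu hu2 huN using
    fun g : MulAction.stabilizer (Matrix.SpecialLinearGroup (Fin n) ℤ) v =>
      exists_mul_of_mem_stabilizer h g.2
  have hend : ∀ g, u g ∈ endRing I := by
    intro g x hx
    rw [hmem] at hx ⊢
    have hle : Submodule.span ℤ (Set.range w) ≤
        (Submodule.span ℤ (Set.range w)).comap (LinearMap.mulLeft ℤ (u g)) := by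
      refine Submodule.span_le.2 ?_
      rintro _ ⟨i, rfl⟩
      change u g * w i ∈ Submodule.span ℤ (Set.range w)
      rw [← congrFun (hu g) i]
      exact span_act_le _ _ (Submodule.subset_span ⟨i, rfl⟩)
    exact hle hx
  have hmul : ∀ g g', u (g * g') = u g * u g' := fun g g' =>
    eq_of_mul_basis_eq w (by
      rw [← hu, Subgroup.coe_mul]
      exact act_coe_mul_of_mul w (hu g) (hu g'))
  let U : MulAction.stabilizer (Matrix.SpecialLinearGroup (Fin n) ℤ) v → (endRing I)ˣ := fun g =>
    ⟨⟨u g, hend g⟩, ⟨u g, hend g⟩, Subtype.ext ((pow_two (u g)).symm.trans (hu2 g)),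
      Subtype.ext ((pow_two (u g)).symm.trans (hu2 g))⟩
  have hU : ∀ g, (((U g : (endRing I)ˣ) : endRing I) : L f) = u g := fun g => rfl
  let E : MulAction.stabilizer (Matrix.SpecialLinearGroup (Fin n) ℤ) v →*
      twoTorsionNormOne (endRing I) :=
    MonoidHom.mk' (fun g => ⟨U g, Units.ext (Subtype.ext (hu2 g)), huN g⟩) fun g g' =>
      Subtype.ext (Units.ext (Subtype.ext (hmul g g')))
  have hE : ∀ g, (((E g : (endRing I)ˣ) : endRing I) : L f) = u g := fun g => rfl
  refine ⟨MulEquiv.ofBijective E ⟨?_, ?_⟩, fun g => (hu g).symm⟩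
  · intro g g' hgg
    have : u g = u g' := by rw [← hE, ← hE, hgg]
    refine Subtype.ext (specialLinear_ext_of_act w ?_)
    rw [hu, hu, this]
  · rintro ⟨x, hx2, hxN⟩
    set z : L f := ((x : endRing I) : L f) with hz
    have hz2 : z ^ 2 = 1 := by
      have := congrArg (fun y : (endRing I)ˣ => ((y : endRing I) : L f)) hx2
      simpa using this
    obtain ⟨g, hg⟩ := exists_act_of_mem_span (b := w) (v := fun i => z * w i) fun i => by
      rw [← hmem]
      exact (x : endRing I).2 _ ((hmem _).2 (Submodule.subset_span ⟨i, rfl⟩))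
    have hdet : g.det = 1 := by
      have h1 := det_act w g w
      rw [← hg, det_mul_left, hxN, Module.Basis.det_self] at h1
      have h2 : (g.det : ℚ) = 1 := by linarith
      exact_mod_cast h2
    have hunit : z * z = 1 := by rw [← pow_two, hz2]
    obtain ⟨G, rfl⟩ : ∃ G : Matrix.SpecialLinearGroup (Fin n) ℤ, G.1 = g := ⟨⟨g, hdet⟩, rfl⟩
    -- The basis Gw = zw has Gram data G•v, and also v, because scaling by z replaces α by z²α = α.
    have hstab : G • v = v := by
      refine isPhiGram_unique (isPhiGram_act h G) ?_
      have h1 := isPhiGram_mul h ⟨z, z, hunit, hunit⟩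
      have h2 : (⟨z, z, hunit, hunit⟩ : (L f)ˣ) ^ 2 = 1 := Units.ext hz2
      rw [h2, one_mul] at h1
      rw [← hg]
      exact h1
    refine ⟨⟨G, hstab⟩, Subtype.ext (Units.ext (Subtype.ext ?_))⟩
    change u ⟨G, hstab⟩ = z
    refine eq_of_mul_basis_eq w ?_
    rw [← hu, hg]

/-! ### The natural basis of `I_f^{n-3}` -/

/-- The determinant over the basis of R_f is exactly 1/f₀^{n-3}; its sign is the orientation and its
absolute value the unsigned norm. -/
theorem natBasis_norm {f : Form n} (hf0 : f 0 ≠ 0) (hn : 2 ≤ n) :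
    ∃ ε : ℤˣ, HasOrientation f (fun i => natBasis f ((n : ℤ) - 3) i) ε ∧
      ((ε : ℤ) : ℚ) * idealNorm f (idealPow f ((n : ℤ) - 3)) = 1 / (f 0 : ℚ) ^ ((n : ℤ) - 3) := by
  have hf : (f 0 : ℚ) ≠ 0 := by exact_mod_cast hf0
  have hdet : (natBasisQ f hf0 0).det (natBasisQ f hf0 ((n : ℤ) - 3)) =
      1 / (f 0 : ℚ) ^ ((n : ℤ) - 3) := by
    have h1 := det_thetaBasis_eq f hf0 (natBasisQ f hf0 ((n : ℤ) - 3))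
    rw [coe_natBasisQ, det_natBasis_eq_pow] at h1
    have h2 : (f 0 : ℚ) ^ (n - ((n : ℤ) - 3 + 1).toNat) * (f 0 : ℚ) ^ ((n : ℤ) - 3) =
        (f 0 : ℚ) ^ (n - 1) := by
      rw [← zpow_natCast, ← zpow_natCast, ← zpow_add₀ hf]
      congr 1
      omega
    rw [eq_div_iff (zpow_ne_zero _ hf)]
    refine mul_left_cancel₀ (pow_ne_zero (n - 1) hf) ?_
    rw [coe_natBasisQ, ← mul_assoc, ← h1, h2, mul_one]
  have hnorm := idealNorm_eq f hf0 (by omega) (idealPow f ((n : ℤ) - 3))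
    (natBasisQ f hf0 ((n : ℤ) - 3))
    (by rw [← natSpan_eq_idealPow f hf0 hn, coe_natBasisQ]; rfl)
  have hne : (1 : ℚ) / (f 0 : ℚ) ^ ((n : ℤ) - 3) ≠ 0 :=
    one_div_ne_zero (zpow_ne_zero _ hf)
  simp only [hasOrientation_iff f hf0, hnorm]
  rw [hdet]
  rw [coe_natBasisQ] at hdet
  rw [hdet]
  rcases lt_or_gt_of_ne hne with h | h
  · exact ⟨-1, by push_cast; linarith, by rw [abs_of_neg h]; push_cast; ring⟩
  · exact ⟨1, by push_cast; linarith, by rw [abs_of_pos h]; push_cast; ring⟩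

end BinForm

theorem corollary4p2 (n : ℕ) (hn : 2 ≤ n) (f : BinForm.Form n) (hf0 : f 0 ≠ 0)
    (hdisc : BinForm.disc f ≠ 0) :
    -- the natural basis of `I_f(n-3)` is a `ℤ`-basis of `I_f^{n-3}`, whose signed norm, for the
    -- orientation given by this basis, is `1 / f₀^{n-3}`
    ((Submodule.span ℤ (Set.range fun i : Fin n => BinForm.natBasis f ((n : ℤ) - 3) i) =
        (BinForm.idealPow f ((n : ℤ) - 3)).restrictScalars ℤ ∧
      LinearIndependent ℤ fun i : Fin n => BinForm.natBasis f ((n : ℤ) - 3) i) ∧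
      ∃ ε : ℤˣ, BinForm.HasOrientation f (fun i => BinForm.natBasis f ((n : ℤ) - 3) i) ε ∧
        ((ε : ℤ) : ℚ) * BinForm.idealNorm f (BinForm.idealPow f ((n : ℤ) - 3)) =
          1 / (f 0 : ℚ) ^ ((n : ℤ) - 3)) ∧
    -- the bijection between orbits and classes: the orbit of `(A, B)` corresponds to the class of
    -- `(I, α)` iff `(A, B)` arises from `(I, α)` through a `ℤ`-basis of `I` of the right orientation
    (∃ Φ : Quotient (BinForm.orbitSetoid f) ≃ Quotient (BinForm.pairSetoid f),
      ∀ (v : BinForm.WithInvariant f) (p : BinForm.IdealPair f),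
        Φ (Quotient.mk (BinForm.orbitSetoid f) v) = Quotient.mk (BinForm.pairSetoid f) p ↔
          ∃ b : Module.Basis (Fin n) ℤ p.I,
            BinForm.HasOrientation f (fun i => (b i : BinForm.L f)) p.ε ∧
              BinForm.IsGram p b v.1) ∧
    -- the stabilizers
    (∀ v : BinForm.WithInvariant f,
      Finite (MulAction.stabilizer (Matrix.SpecialLinearGroup (Fin n) ℤ) v.1) ∧
      (∀ g ∈ MulAction.stabilizer (Matrix.SpecialLinearGroup (Fin n) ℤ) v.1, g ^ 2 = 1) ∧
      ∀ (p : BinForm.IdealPair f) (b : Module.Basis (Fin n) ℤ p.I), BinForm.IsGram p b v.1 →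
        ∃ e : MulAction.stabilizer (Matrix.SpecialLinearGroup (Fin n) ℤ) v.1 ≃*
            BinForm.twoTorsionNormOne (BinForm.endRing p.I),
          ∀ (g : MulAction.stabilizer (Matrix.SpecialLinearGroup (Fin n) ℤ) v.1) (i : Fin n),
            (((e g : (BinForm.endRing p.I)ˣ) : BinForm.endRing p.I) : BinForm.L f) *
                (b i : BinForm.L f) =
              ∑ j, (g : Matrix.SpecialLinearGroup (Fin n) ℤ).1 i j • (b j : BinForm.L f)) := by
  refine ⟨⟨⟨BinForm.natSpan_eq_idealPow f hf0 hn, ?_⟩, BinForm.natBasis_norm hf0 hn⟩,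
    BinForm.exists_orbit_equiv hf0 hn hdisc, fun v => ?_⟩
  · exact (LinearIndependent.iff_fractionRing ℤ ℚ).2 (BinForm.natBasis_isBasis f hf0 _).1
  -- Finiteness and exponent 2 need only some realization over ℚ. The isomorphism uses the given
  -- basis b, whose orientation plays no role in the Gram condition.
  · obtain ⟨α, w, hg⟩ := BinForm.exists_isPhiGram hn hf0 hdisc v.2
    refine ⟨BinForm.finite_stabilizer hg,
      fun g hgv => BinForm.sq_eq_one_of_mem_stabilizer hg hgv, fun p b hb => ?_⟩
    obtain ⟨w', hw', hI⟩ := BinForm.exists_basisQ hf0 b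
    have hwb : ⇑w' = fun i => (b i : BinForm.L f) := funext hw'
    rw [BinForm.isGram_iff hf0 hn, ← hwb] at hb
    obtain ⟨e, he⟩ := BinForm.exists_stabilizer_equiv hb hI
    refine ⟨e, fun g i => ?_⟩
    have := congrFun (he g) i
    simp only [BinForm.act, hw'] at this
    exact this
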